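/- Fix $\Lambda>0$ and let $\Omega_\Lambda=(-\infty,-\Lambda)\cup(\Lambda,\infty)$. Let $AC^2(\overline{\Omega_\Lambda})$ be the set of functions $u$ on $\overline{\Omega_\Lambda}$ that are differentiable there (one-sidedly at $\pm\Lambda$), such that $u$ and $u'$ are absolutely continuous on every compact interval contained in $\overline{\Omega_\Lambda}$ and $u''\in L^2(\Omega_\Lambda)$; for $\psi\in L^2(\Omega_\Lambda)$ with a representative in $AC^2(\overline{\Omega_\Lambda})$, the values $\psi(\pm\Lambda),\psi'(\pm\Lambda)$ are those of this representative. Let $H_{00}=-d^2/dx^2$ on $C_0^\infty(\Omega_\Lambda)$, let $H_0=\overline{H_{00}}$ be its closure in $L^2(\Omega_\Lambda)$ and $H_0^*$ the adjoint of $H_0$. A self-adjoint extension of $H_0$ is an operator $B=B^*$ with $H_0\subset B$; equality of operators includes equality of domains. Let $\alpha_1,\alpha_2,\alpha_3,\alpha_4\in\mathbb C$ satisfy $\alpha_1\overline{\alpha_4}-\overline{\alpha_2}\,\alpha_3=1$ and $\alpha_1\overline{\alpha_3},\ \alpha_2\overline{\alpha_4}\in\mathbb R$. (i) Let $H_{\vec\alpha}=-d^2/dx^2$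 with domain the set of all $\psi\in D(H_0^*)$ (with a representative in $AC^2(\overline{\Omega_\Lambda})$) such that $$\psi(\Lambda)=\alpha_1\psi(-\Lambda)+\alpha_2\psi'(-\Lambda),\qquad \psi'(\Lambda)=\alpha_3\psi(-\Lambda)+\alpha_4\psi'(-\Lambda).$$ Then $H_{\vec\alpha}$ is a self-adjoint extension of $H_0$. (ii) Let $N=2^{1/4}e^{\Lambda/\sqrt2}$ and define on $\Omega_\Lambda$ the functions $R_\pm(x)=Ne^{(-1\pm i)x/\sqrt2}$ for $x>\Lambda$, $R_\pm(x)=0$ for $x<-\Lambda$, and $L_\pm(x)=Ne^{(1\mp i)x/\sqrt2}$ for $x<-\Lambda$, $L_\pm(x)=0$ for $x>\Lambda$. Suppose in addition that $\vec\alpha$ solves the system $$F(\alpha_1,\alpha_2)=0=F(\alpha_3,\alpha_4),$$ $$\alpha_1+\alpha_2e^{-i\pi/4}=(\alpha_3+\alpha_4e^{-i\pi/4})e^{i3\pi/4},\qquad \alpha_1+\alpha_2e^{i\pi/4}=(\alpha_3+\alpha_4e^{i\pi/4})e^{-i3\pi/4},$$ where either $F(z_1,z_2)=|z_1|^2+\sqrt2\,z_1z_2+|z_2|^2-1$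 or $F(z_1,z_2)=|z_1|^2+\sqrt2\,z_1\overline{z_2}+|z_2|^2-1$. Put $$\gamma_\to=(\alpha_1+\alpha_2e^{-i\pi/4})e^{i\sqrt2\Lambda},\qquad \gamma_\leftarrow=(\alpha_1+\alpha_2e^{i\pi/4})^{-1}e^{i\sqrt2\Lambda}.$$ Then also $$\gamma_\to=(\alpha_3+\alpha_4e^{-i\pi/4})e^{i\{\sqrt2\Lambda+3\pi/4\}},\qquad \gamma_\leftarrow=(\alpha_3+\alpha_4e^{i\pi/4})^{-1}e^{i\{\sqrt2\Lambda+3\pi/4\}},$$ and $|\gamma_\to|=|\gamma_\leftarrow|=1$. Let $H_\gamma=-d^2/dx^2$ with domain $$D(H_\gamma)=\{\psi_0+c_L(L_++\gamma_\to R_-)+c_R(R_++\gamma_\leftarrow L_-)\ :\ \psi_0\in D(H_0),\ c_L,c_R\in\mathbb C\}$$ (every element of which has a representative in $AC^2(\overline{\Omega_\Lambda})$). Then $H_\gamma$ is a self-adjoint extension of $H_0$, and $H_{\vec\alpha}=H_\gamma$. -/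

import Mathlib

open MeasureTheory Set Filter
open scoped ComplexConjugate ENNReal

namespace Junction

noncomputable section

/-! ### The line with the junction `[-Λ, Λ]` removed -/

/-- `Ω_Λ = (-∞, -Λ) ∪ (Λ, ∞)`. -/
def region (Λ : ℝ) : Set ℝ := Iio (-Λ) ∪ Ioi Λ

/-- The closure `(-∞, -Λ] ∪ [Λ, ∞)` of `Ω_Λ`. -/
def closedRegion (Λ : ℝ) : Set ℝ := Iic (-Λ) ∪ Ici Λ

/-- Lebesgue measure on `Ω_Λ`. -/
abbrev regionMeasure (Λ : ℝ) : Measure ℝ := volume.restrict (region Λ)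

/-- The Hilbert space `L²(Ω_Λ)`. -/
abbrev L2 (Λ : ℝ) : Type := Lp ℂ 2 (regionMeasure Λ)

/-! ### Absolutely continuous functions -/

/-- Absolute continuity on the closed region: absolute continuity on every compact interval that is
contained in it. -/
def LocAC (Λ : ℝ) (f : ℝ → ℂ) : Prop :=
  ∀ a b : ℝ, a ≤ b → Icc a b ⊆ closedRegion Λ → AbsolutelyContinuousOnInterval f a b

/-- The derivative relative to the closed region: the usual derivative at interior points, the
one-sided derivative at `-Λ` and at `Λ`. -/
def D (Λ : ℝ) (f : ℝ → ℂ) : ℝ → ℂ := derivWithin f (closedRegion Λ)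

/-- The class `AC²`: `u` is absolutely continuous and differentiable, `u'` is absolutely continuous,
and `u''` (which exists almost everywhere) is square integrable. -/
structure IsAC2 (Λ : ℝ) (u : ℝ → ℂ) : Prop where
  ac : LocAC Λ u
  diff : ∀ x ∈ closedRegion Λ, DifferentiableWithinAt ℝ u (closedRegion Λ) x
  ac_deriv : LocAC Λ (D Λ u)
  memLp_deriv2 : MemLp (D Λ (D Λ u)) 2 (regionMeasure Λ)

/-! #### Facts used in the construction of the operators -/

theorem isOpen_region (Λ : ℝ) : IsOpen (region Λ) := isOpen_Iio.union isOpen_Ioi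

theorem region_subset (Λ : ℝ) : region Λ ⊆ closedRegion Λ :=
  union_subset_union Iio_subset_Iic_self Ioi_subset_Ici_self

theorem closedRegion_mem_nhds {Λ x : ℝ} (hx : x ∈ region Λ) : closedRegion Λ ∈ nhds x :=
  Filter.mem_of_superset ((isOpen_region Λ).mem_nhds hx) (region_subset Λ)

theorem ae_mem_region (Λ : ℝ) : ∀ᵐ x ∂(regionMeasure Λ), x ∈ region Λ :=
  ae_restrict_mem (isOpen_region Λ).measurableSet

theorem D_eq_deriv {Λ x : ℝ} (f : ℝ → ℂ) (hx : x ∈ region Λ) : D Λ f x = deriv f x :=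
  derivWithin_of_mem_nhds (closedRegion_mem_nhds hx)

theorem LocAC.congr {Λ : ℝ} {f g : ℝ → ℂ} (hf : LocAC Λ f) (h : EqOn f g (closedRegion Λ)) :
    LocAC Λ g := by
  intro a b hab hs
  have hf' := hf a b hab hs
  rw [absolutelyContinuousOnInterval_iff] at hf' ⊢
  intro ε hε
  obtain ⟨δ, hδ, H⟩ := hf' ε hε
  refine ⟨δ, hδ, fun E hE hlt => ?_⟩
  have hlt' := H E hE hlt
  have hmem : ∀ i ∈ Finset.range E.1, (E.2 i).1 ∈ uIcc a b ∧ (E.2 i).2 ∈ uIcc a b := hE.1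
  rw [uIcc_of_le hab] at hmem
  refine lt_of_eq_of_lt (Finset.sum_congr rfl fun i hi => ?_) hlt'
  rw [h (hs (hmem i hi).1), h (hs (hmem i hi).2)]

theorem LocAC.add {Λ : ℝ} {f g : ℝ → ℂ} (hf : LocAC Λ f) (hg : LocAC Λ g) :
    LocAC Λ (fun x => f x + g x) :=
  fun a b hab hs => (hf a b hab hs).fun_add (hg a b hab hs)

theorem LocAC.smul {Λ : ℝ} {f : ℝ → ℂ} (c : ℂ) (hf : LocAC Λ f) :
    LocAC Λ (fun x => c * f x) :=
  fun a b hab hs => (hf a b hab hs).const_smul c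

theorem LocAC.ae_differentiableAt {Λ : ℝ} {f : ℝ → ℂ} (hf : LocAC Λ f) :
    ∀ᵐ x ∂(regionMeasure Λ), DifferentiableAt ℝ f x := by
  have key : ∀ s : Set ℝ, s.OrdConnected → s ⊆ closedRegion Λ →
      ∀ᵐ x : ℝ, x ∈ s → DifferentiableWithinAt ℝ f s x := by
    intro s hs hsub
    apply LocallyBoundedVariationOn.ae_differentiableWithinAt_of_mem
    intro a b ha hb
    rcases le_total a b with hab | hab
    · have h1 := (hf a b hab ((hs.out ha hb).trans hsub)).boundedVariationOn
      rw [uIcc_of_le hab] at h1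
      exact h1.mono inter_subset_right
    · have hss : (s ∩ Icc a b).Subsingleton := fun x hx y hy => by
        have h1 := hx.2
        have h2 := hy.2
        simp only [mem_Icc] at h1 h2
        linarith [h1.1, h1.2, h2.1, h2.2]
      rw [BoundedVariationOn, eVariationOn.subsingleton f hss]
      exact ENNReal.zero_ne_top
  have h1 := key (Iic (-Λ)) ordConnected_Iic subset_union_left
  have h2 := key (Ici Λ) ordConnected_Ici subset_union_right
  filter_upwards [ae_mem_region Λ, ae_restrict_of_ae h1, ae_restrict_of_ae h2] with x hx h1 h2
  rcases hx with hx | hx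
  · exact (h1 (Iio_subset_Iic_self hx)).differentiableAt (Iic_mem_nhds hx)
  · exact (h2 (Ioi_subset_Ici_self hx)).differentiableAt (Ici_mem_nhds hx)

theorem LocAC.continuousOn {Λ : ℝ} {f : ℝ → ℂ} (hf : LocAC Λ f) : ContinuousOn f (region Λ) := by
  intro x hx
  obtain ⟨ε, hε, hball⟩ := Metric.isOpen_iff.1 (isOpen_region Λ) x hx
  have hsub : Icc (x - ε / 2) (x + ε / 2) ⊆ region Λ := fun y hy => hball (by
    rw [Metric.mem_ball, Real.dist_eq, abs_lt]; constructor <;> linarith [hy.1, hy.2])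
  have h := (hf _ _ (by linarith) (hsub.trans (region_subset Λ))).continuousOn
  rw [uIcc_of_le (by linarith)] at h
  exact (h.continuousAt (Icc_mem_nhds (by linarith) (by linarith))).continuousWithinAt

theorem IsAC2.D_add {Λ : ℝ} {u v : ℝ → ℂ} (hu : IsAC2 Λ u) (hv : IsAC2 Λ v) :
    EqOn (fun x => D Λ u x + D Λ v x) (D Λ (fun x => u x + v x)) (closedRegion Λ) :=
  fun x hx => (derivWithin_fun_add (hu.diff x hx) (hv.diff x hx)).symm

theorem IsAC2.D_smul {Λ : ℝ} {u : ℝ → ℂ} (c : ℂ) (hu : IsAC2 Λ u) :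
    EqOn (fun x => c * D Λ u x) (D Λ (fun x => c * u x)) (closedRegion Λ) :=
  fun x hx => (derivWithin_const_mul c (hu.diff x hx)).symm

theorem IsAC2.D2_add {Λ : ℝ} {u v : ℝ → ℂ} (hu : IsAC2 Λ u) (hv : IsAC2 Λ v) :
    (fun x => D Λ (D Λ u) x + D Λ (D Λ v) x) =ᵐ[regionMeasure Λ]
      D Λ (D Λ (fun x => u x + v x)) := by
  filter_upwards [ae_mem_region Λ, hu.ac_deriv.ae_differentiableAt,
    hv.ac_deriv.ae_differentiableAt] with x hx h1 h2
  have h3 := derivWithin_congr (hu.D_add hv) (hu.D_add hv (region_subset Λ hx))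
  exact ((derivWithin_fun_add h1.differentiableWithinAt h2.differentiableWithinAt).symm.trans h3)

theorem IsAC2.D2_smul {Λ : ℝ} {u : ℝ → ℂ} (c : ℂ) (hu : IsAC2 Λ u) :
    (fun x => c * D Λ (D Λ u) x) =ᵐ[regionMeasure Λ] D Λ (D Λ (fun x => c * u x)) := by
  filter_upwards [ae_mem_region Λ, hu.ac_deriv.ae_differentiableAt] with x hx h1
  have h3 := derivWithin_congr (hu.D_smul c) (hu.D_smul c (region_subset Λ hx))
  exact ((derivWithin_const_mul c h1.differentiableWithinAt).symm.trans h3)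

theorem IsAC2.add {Λ : ℝ} {u v : ℝ → ℂ} (hu : IsAC2 Λ u) (hv : IsAC2 Λ v) :
    IsAC2 Λ (fun x => u x + v x) where
  ac := hu.ac.add hv.ac
  diff x hx := (hu.diff x hx).fun_add (hv.diff x hx)
  ac_deriv := (hu.ac_deriv.add hv.ac_deriv).congr (hu.D_add hv)
  memLp_deriv2 := (hu.memLp_deriv2.add hv.memLp_deriv2).ae_eq (hu.D2_add hv)

theorem IsAC2.smul {Λ : ℝ} {u : ℝ → ℂ} (c : ℂ) (hu : IsAC2 Λ u) :
    IsAC2 Λ (fun x => c * u x) where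
  ac := hu.ac.smul c
  diff x hx := (hu.diff x hx).const_mul c
  ac_deriv := (hu.ac_deriv.smul c).congr (hu.D_smul c)
  memLp_deriv2 := (hu.memLp_deriv2.const_mul c).ae_eq (hu.D2_smul c)

theorem D_zero (Λ : ℝ) : D Λ (fun _ => 0) = fun _ => 0 := by
  funext x; simp [D]

theorem IsAC2.zero (Λ : ℝ) : IsAC2 Λ (fun _ => 0) where
  ac := fun _ _ _ _ => contDiffOn_const.absolutelyContinuousOnInterval
  diff _ _ := differentiableWithinAt_const _
  ac_deriv := by
    rw [D_zero]; exact fun _ _ _ _ => contDiffOn_const.absolutelyContinuousOnInterval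
  memLp_deriv2 := by rw [D_zero, D_zero]; exact MemLp.zero

/-- Two `AC²` representatives of the same class agree on `Ω_Λ`. -/
theorem IsAC2.eqOn_of_ae {Λ : ℝ} {u v : ℝ → ℂ} (hu : IsAC2 Λ u) (hv : IsAC2 Λ v)
    (h : u =ᵐ[regionMeasure Λ] v) : EqOn u v (region Λ) :=
  Measure.eqOn_open_of_ae_eq h (isOpen_region Λ) hu.ac.continuousOn hv.ac.continuousOn

theorem eqOn_D {Λ : ℝ} {u v : ℝ → ℂ} (h : EqOn u v (region Λ)) :
    EqOn (D Λ u) (D Λ v) (region Λ) := by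
  intro x hx
  rw [D_eq_deriv u hx, D_eq_deriv v hx]
  exact (h.eventuallyEq_of_mem ((isOpen_region Λ).mem_nhds hx)).deriv_eq

theorem IsAC2.D2_ae_eq {Λ : ℝ} {u v : ℝ → ℂ} (hu : IsAC2 Λ u) (hv : IsAC2 Λ v)
    (h : u =ᵐ[regionMeasure Λ] v) : D Λ (D Λ u) =ᵐ[regionMeasure Λ] D Λ (D Λ v) := by
  filter_upwards [ae_mem_region Λ] with x hx using eqOn_D (eqOn_D (hu.eqOn_of_ae hv h)) hx

/-! ### The differential operator `-d²/dx²` -/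

/-- The classes in `L²(Ω_Λ)` with an `AC²` representative. -/
def maxDomain (Λ : ℝ) : Submodule ℂ (L2 Λ) where
  carrier := {ψ | ∃ u : ℝ → ℂ, IsAC2 Λ u ∧ ψ =ᵐ[regionMeasure Λ] u}
  zero_mem' := ⟨fun _ => 0, IsAC2.zero Λ, Lp.coeFn_zero ℂ 2 (regionMeasure Λ)⟩
  add_mem' := by
    rintro ψ φ ⟨u, hu, hψ⟩ ⟨v, hv, hφ⟩
    exact ⟨_, hu.add hv, (Lp.coeFn_add ψ φ).trans (hψ.add hφ)⟩
  smul_mem' := by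
    rintro c ψ ⟨u, hu, hψ⟩
    exact ⟨_, hu.smul c, (Lp.coeFn_smul c ψ).trans (hψ.const_smul c)⟩

/-- `-u''` for an `AC²` representative `u` of `ψ`. -/
def negDeriv2 (Λ : ℝ) (ψ : maxDomain Λ) : L2 Λ :=
  (ψ.2.choose_spec.1.memLp_deriv2.neg).toLp (-(D Λ (D Λ ψ.2.choose)))

theorem negDeriv2_ae_eq {Λ : ℝ} (ψ : maxDomain Λ) {u : ℝ → ℂ} (hu : IsAC2 Λ u)
    (hψ : (ψ : L2 Λ) =ᵐ[regionMeasure Λ] u) :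
    negDeriv2 Λ ψ =ᵐ[regionMeasure Λ] fun x => -(D Λ (D Λ u) x) := by
  have h := ψ.2.choose_spec
  refine (MemLp.coeFn_toLp h.1.memLp_deriv2.neg).trans ?_
  exact (h.1.D2_ae_eq hu (h.2.symm.trans hψ)).neg

/-- The operator `-d²/dx²` on all classes in `L²(Ω_Λ)` with an `AC²` representative. All operators
below are restrictions of it. -/
def negLaplacian (Λ : ℝ) : L2 Λ →ₗ.[ℂ] L2 Λ where
  domain := maxDomain Λ
  toFun :=
    { toFun := negDeriv2 Λ
      map_add' := by
        intro ψ φ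
        obtain ⟨u, hu, hψ⟩ := ψ.2
        obtain ⟨v, hv, hφ⟩ := φ.2
        apply Lp.ext
        have h1 := negDeriv2_ae_eq (ψ + φ) (hu.add hv)
          ((Lp.coeFn_add (ψ : L2 Λ) φ).trans (hψ.add hφ))
        filter_upwards [h1, negDeriv2_ae_eq ψ hu hψ, negDeriv2_ae_eq φ hv hφ, hu.D2_add hv,
          Lp.coeFn_add (negDeriv2 Λ ψ) (negDeriv2 Λ φ)] with x h1 h2 h3 h4 h5
        rw [h5, h1, Pi.add_apply, h2, h3, ← h4]
        ring
      map_smul' := by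
        intro c ψ
        obtain ⟨u, hu, hψ⟩ := ψ.2
        apply Lp.ext
        have h1 := negDeriv2_ae_eq (c • ψ) (hu.smul c)
          ((Lp.coeFn_smul c (ψ : L2 Λ)).trans (hψ.const_smul c))
        filter_upwards [h1, negDeriv2_ae_eq ψ hu hψ, hu.D2_smul c,
          Lp.coeFn_smul c (negDeriv2 Λ ψ)] with x h1 h2 h4 h5
        simp only [RingHom.id_apply]
        rw [h5, h1, Pi.smul_apply, h2, ← h4, smul_eq_mul]
        ring }

/-! ### The minimal operator -/

/-- The subspace `C₀^∞(Ω_Λ)` of `L²(Ω_Λ)`. -/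
def testSpace (Λ : ℝ) : Submodule ℂ (L2 Λ) where
  carrier := {ψ | ∃ u : ℝ → ℂ, ContDiff ℝ (⊤ : ℕ∞) u ∧ HasCompactSupport u ∧
    tsupport u ⊆ region Λ ∧ ψ =ᵐ[regionMeasure Λ] u}
  zero_mem' := ⟨fun _ => 0, contDiff_const, HasCompactSupport.zero,
    by simp [tsupport], Lp.coeFn_zero ℂ 2 (regionMeasure Λ)⟩
  add_mem' := by
    rintro ψ φ ⟨u, hu, hu', hus, hψ⟩ ⟨v, hv, hv', hvs, hφ⟩
    exact ⟨u + v, hu.add hv, hu'.add hv', (tsupport_add u v).trans (union_subset hus hvs),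
      (Lp.coeFn_add ψ φ).trans (hψ.add hφ)⟩
  smul_mem' := by
    rintro c ψ ⟨u, hu, hu', hus, hψ⟩
    refine ⟨c • u, hu.const_smul c, ?_, ?_, (Lp.coeFn_smul c ψ).trans (hψ.const_smul c)⟩
    · exact hu'.mono (Function.support_const_smul_subset c u)
    · exact (closure_mono (Function.support_const_smul_subset c u)).trans hus

/-- Test functions lie in the domain of `negLaplacian`, so that `H00` has domain `C₀^∞(Ω_Λ)`. -/
theorem testSpace_le_maxDomain (Λ : ℝ) : testSpace Λ ≤ maxDomain Λ := by
  rintro ψ ⟨u, hu, hu', hus, hψ⟩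
  have hdiff : ∀ {f : ℝ → ℂ}, ContDiff ℝ (⊤ : ℕ∞) f → tsupport f ⊆ region Λ →
      EqOn (deriv f) (D Λ f) (closedRegion Λ) := by
    intro f hf hfs x hx
    by_cases hxr : x ∈ region Λ
    · exact (D_eq_deriv f hxr).symm
    · have h0 : f =ᶠ[nhds x] fun _ => 0 :=
        notMem_tsupport_iff_eventuallyEq.1 fun h => hxr (hfs h)
      rw [h0.deriv_eq, D, (h0.filter_mono nhdsWithin_le_nhds).derivWithin_eq h0.eq_of_nhds]
      simp
  have hd1 : ContDiff ℝ (⊤ : ℕ∞) (deriv u) := by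
    have := hu.iterate_deriv 1
    simpa using this
  have hd2 : ContDiff ℝ (⊤ : ℕ∞) (deriv (deriv u)) := by
    have := hu.iterate_deriv 2
    simpa using this
  have hac : ∀ {f : ℝ → ℂ}, ContDiff ℝ (⊤ : ℕ∞) f → LocAC Λ f := fun hf a b _ _ =>
    (hf.of_le (by exact_mod_cast le_top)).contDiffOn.absolutelyContinuousOnInterval
  refine ⟨u, ⟨hac hu, fun x _ => ?_, (hac hd1).congr (hdiff hu hus), ?_⟩, hψ⟩
  · exact (hu.differentiable (by simp)).differentiableAt.differentiableWithinAt
  · have h2 : MemLp (deriv (deriv u)) 2 (regionMeasure Λ) :=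
      hd2.continuous.memLp_of_hasCompactSupport hu'.deriv.deriv
    refine h2.ae_eq ?_
    filter_upwards [ae_mem_region Λ] with x hx
    have h3 : EqOn (deriv u) (D Λ u) (region Λ) := (hdiff hu hus).mono (region_subset Λ)
    rw [← eqOn_D h3 hx, D_eq_deriv _ hx]

/-- `H₀₀ = -d²/dx²` with domain `C₀^∞(Ω_Λ)`. -/
def H00 (Λ : ℝ) : L2 Λ →ₗ.[ℂ] L2 Λ := (negLaplacian Λ).domRestrict (testSpace Λ)

/-- `H₀`, the closure of `H₀₀`. -/
def H0 (Λ : ℝ) : L2 Λ →ₗ.[ℂ] L2 Λ := (H00 Λ).closure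

/-- `B` is a self-adjoint extension of `A`: `A ⊆ B` and `B† = B`. -/
def IsSelfAdjointExtension {Λ : ℝ} (A B : L2 Λ →ₗ.[ℂ] L2 Λ) : Prop :=
  A ≤ B ∧ IsSelfAdjoint B

/-! ### Coupled boundary conditions -/

/-- The class `𝒜`. -/
def ClassA (α₁ α₂ α₃ α₄ : ℂ) : Prop :=
  α₁ * conj α₄ - conj α₂ * α₃ = 1 ∧ (α₁ * conj α₃).im = 0 ∧ (α₂ * conj α₄).im = 0

/-- The boundary condition `BC(α)`. -/
def BC (Λ : ℝ) (α₁ α₂ α₃ α₄ : ℂ) (u : ℝ → ℂ) : Prop :=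
  u Λ = α₁ * u (-Λ) + α₂ * D Λ u (-Λ) ∧ D Λ u Λ = α₃ * u (-Λ) + α₄ * D Λ u (-Λ)

theorem neg_mem_closedRegion (Λ : ℝ) : -Λ ∈ closedRegion Λ := Or.inl self_mem_Iic

theorem mem_closedRegion (Λ : ℝ) : Λ ∈ closedRegion Λ := Or.inr self_mem_Ici

/-- The `ψ` in `D(H₀*)` that satisfy `BC(α)`. Boundary values are those of an `AC²` representative
of `ψ`. -/
def alphaDomain (Λ : ℝ) (α₁ α₂ α₃ α₄ : ℂ) : Submodule ℂ (L2 Λ) where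
  carrier := {ψ | ψ ∈ (H0 Λ).adjoint.domain ∧
    ∃ u : ℝ → ℂ, IsAC2 Λ u ∧ ψ =ᵐ[regionMeasure Λ] u ∧ BC Λ α₁ α₂ α₃ α₄ u}
  zero_mem' := ⟨zero_mem _, fun _ => 0, IsAC2.zero Λ, Lp.coeFn_zero ℂ 2 (regionMeasure Λ),
    by simp [BC, D_zero]⟩
  add_mem' := by
    rintro ψ φ ⟨hψ0, u, hu, hψ, h1, h2⟩ ⟨hφ0, v, hv, hφ, h3, h4⟩
    refine ⟨add_mem hψ0 hφ0, _, hu.add hv, (Lp.coeFn_add ψ φ).trans (hψ.add hφ), ?_⟩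
    have e1 := hu.D_add hv (neg_mem_closedRegion Λ)
    have e2 := hu.D_add hv (mem_closedRegion Λ)
    simp only at e1 e2
    constructor
    · rw [← e1]; simp only; rw [h1, h3]; ring
    · rw [← e1, ← e2, h2, h4]; ring
  smul_mem' := by
    rintro c ψ ⟨hψ0, u, hu, hψ, h1, h2⟩
    refine ⟨Submodule.smul_mem _ c hψ0, _, hu.smul c,
      (Lp.coeFn_smul c ψ).trans (hψ.const_smul c), ?_⟩
    have e1 := hu.D_smul c (neg_mem_closedRegion Λ)
    have e2 := hu.D_smul c (mem_closedRegion Λ)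
    simp only at e1 e2
    constructor
    · rw [← e1]; simp only; rw [h1]; ring
    · rw [← e1, ← e2, h2]; ring

/-- `H_α = -d²/dx²` on `alphaDomain`. -/
def Halpha (Λ : ℝ) (α₁ α₂ α₃ α₄ : ℂ) : L2 Λ →ₗ.[ℂ] L2 Λ :=
  (negLaplacian Λ).domRestrict (alphaDomain Λ α₁ α₂ α₃ α₄)

/-- The function `F` of the system `𝒮`, in its literal form. -/
def F (z₁ z₂ : ℂ) : ℂ :=
  (‖z₁‖ : ℂ) ^ 2 + (√2 : ℝ) * z₁ * z₂ + (‖z₂‖ : ℂ) ^ 2 - 1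

/-- The sesquilinear variant of `F`, with `z₁ z₂*` in place of `z₁ z₂`. -/
def Fconj (z₁ z₂ : ℂ) : ℂ :=
  (‖z₁‖ : ℂ) ^ 2 + (√2 : ℝ) * z₁ * conj z₂ + (‖z₂‖ : ℂ) ^ 2 - 1

/-- `phase t = e^{it}`. -/
def phase (t : ℝ) : ℂ := Complex.exp (t * Complex.I)

/-- `α` solves the system `𝒮` formed with the function `G`. -/
def SystemS (G : ℂ → ℂ → ℂ) (α₁ α₂ α₃ α₄ : ℂ) : Prop :=
  (G α₁ α₂ = 0 ∧ G α₃ α₄ = 0) ∧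
  α₁ + α₂ * phase (-(Real.pi / 4)) =
    (α₃ + α₄ * phase (-(Real.pi / 4))) * phase (3 * Real.pi / 4) ∧
  α₁ + α₂ * phase (Real.pi / 4) =
    (α₃ + α₄ * phase (Real.pi / 4)) * phase (-(3 * Real.pi / 4))

/-! ### Deficiency vectors and the extension `H_γ` -/

/-- The normalisation factor `2^{1/4} e^{Λ/√2}`. -/
def normFactor (Λ : ℝ) : ℝ := (2 : ℝ) ^ (1 / 4 : ℝ) * Real.exp (Λ / √2)

/-- `R₊`. -/
def Rplus (Λ : ℝ) (x : ℝ) : ℂ :=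
  if Λ < x then normFactor Λ * Complex.exp ((-1 + Complex.I) * x / (√2 : ℝ)) else 0

/-- `R₋`. -/
def Rminus (Λ : ℝ) (x : ℝ) : ℂ :=
  if Λ < x then normFactor Λ * Complex.exp ((-1 - Complex.I) * x / (√2 : ℝ)) else 0

/-- `L₊`. -/
def Lplus (Λ : ℝ) (x : ℝ) : ℂ :=
  if x < -Λ then normFactor Λ * Complex.exp ((1 - Complex.I) * x / (√2 : ℝ)) else 0

/-- `L₋`. -/
def Lminus (Λ : ℝ) (x : ℝ) : ℂ :=
  if x < -Λ then normFactor Λ * Complex.exp ((1 + Complex.I) * x / (√2 : ℝ)) else 0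

/-- All `ψ₀ + c_L (L₊ + γ_→ R₋) + c_R (R₊ + γ_← L₋)` with `ψ₀ ∈ D(H₀)` and complex `c_L`, `c_R`. -/
def gammaDomain (Λ : ℝ) (γr γl : ℂ) : Submodule ℂ (L2 Λ) where
  carrier := {ψ | ∃ ψ₀ ∈ (H0 Λ).domain, ∃ cL cR : ℂ, ψ =ᵐ[regionMeasure Λ] fun x =>
    ψ₀ x + cL * (Lplus Λ x + γr * Rminus Λ x) + cR * (Rplus Λ x + γl * Lminus Λ x)}
  zero_mem' := ⟨0, zero_mem _, 0, 0, by simp⟩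
  add_mem' := by
    rintro ψ φ ⟨ψ₀, hψ₀, a, b, hψ⟩ ⟨φ₀, hφ₀, c, d, hφ⟩
    refine ⟨ψ₀ + φ₀, add_mem hψ₀ hφ₀, a + c, b + d, ?_⟩
    filter_upwards [hψ, hφ, Lp.coeFn_add ψ φ, Lp.coeFn_add ψ₀ φ₀] with x h1 h2 h3 h4
    rw [h3, h4, Pi.add_apply, Pi.add_apply, h1, h2]
    ring
  smul_mem' := by
    rintro k ψ ⟨ψ₀, hψ₀, a, b, hψ⟩
    refine ⟨k • ψ₀, Submodule.smul_mem _ k hψ₀, k * a, k * b, ?_⟩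
    filter_upwards [hψ, Lp.coeFn_smul k ψ, Lp.coeFn_smul k ψ₀] with x h1 h3 h4
    rw [h3, h4, Pi.smul_apply, Pi.smul_apply, h1, smul_eq_mul, smul_eq_mul]
    ring

/-- `H_γ = -d²/dx²` on `gammaDomain` with `γ = (γ_→, γ_←)`. -/
def Hgamma (Λ : ℝ) (γr γl : ℂ) : L2 Λ →ₗ.[ℂ] L2 Λ :=
  (negLaplacian Λ).domRestrict (gammaDomain Λ γr γl)

end

end Junction

/-!
A locally integrable function that is orthogonal to the second derivatives of all test functions
on `Ω_Λ` is affine on each half-line, so `H₀*` is `-d²/dx²` on all classes with a representative in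
`AC²`. Square integrability of `u` and `u''` forces `u` and `u'` to vanish at infinity, and Green's
formula therefore leaves only boundary terms at `±Λ`. Hence the domain of `H₀` consists of the
functions whose boundary data all vanish, and a restriction of `H₀*` by a boundary condition is
self-adjoint exactly when the condition equals its dual with respect to the boundary form; class
`𝒜` says that the matrix of `α` preserves this form.

For part (ii), the linear equations of the system `𝒮` say that `L₊ + γ_→ R₋` and `R₊ + γ_← L₋`
satisfy the boundary condition of `H_α`. Their combinations realise all data at `-Λ`, so every
element of `D(H_α)` differs from such a combination by an element of `D(H₀)`. Each of the two waves
satisfies `u'(-Λ) = k u(-Λ)` and `u'(Λ) = -conj k u(Λ)` with `|k| = 1` and `k` not real, so the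
invariance of the boundary form under `α` gives `|u(Λ)| = |u(-Λ)|`, which is `|γ| = 1`.
-/

namespace Junction

open scoped Interval

section AbsolutelyContinuous

variable {X Y : Type*} [PseudoMetricSpace X] [PseudoMetricSpace Y]
  {E F : Type*} [NormedAddCommGroup E] [NormedSpace ℝ E] [NormedAddCommGroup F] [NormedSpace ℝ F]
  {a b : ℝ}

theorem absolutelyContinuousOnInterval_of_dist_le {f : ℝ → X} {g : ℝ → Y} {C : ℝ}
    (hf : AbsolutelyContinuousOnInterval f a b)
    (hfg : ∀ x ∈ uIcc a b, ∀ y ∈ uIcc a b, dist (g x) (g y) ≤ C * dist (f x) (f y)) :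
    AbsolutelyContinuousOnInterval g a b := by
  have hlim := Tendsto.const_mul C hf
  rw [mul_zero] at hlim
  refine squeeze_zero' (.of_forall fun I => Finset.sum_nonneg fun _ _ => dist_nonneg) ?_ hlim
  filter_upwards [mem_inf_of_right (mem_principal_self _)] with I hI
  rw [Finset.mul_sum]
  exact Finset.sum_le_sum fun i hi => hfg _ (hI.1 i hi).1 _ (hI.1 i hi).2

theorem absolutelyContinuousOnInterval_congr {f g : ℝ → X}
    (hf : AbsolutelyContinuousOnInterval f a b) (hfg : EqOn f g (uIcc a b)) :
    AbsolutelyContinuousOnInterval g a b :=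
  absolutelyContinuousOnInterval_of_dist_le (C := 1) hf fun x hx y hy => by
    rw [hfg hx, hfg hy, one_mul]

theorem absolutelyContinuousOnInterval_clm_comp (L : E →L[ℝ] F) {f : ℝ → E}
    (hf : AbsolutelyContinuousOnInterval f a b) :
    AbsolutelyContinuousOnInterval (fun x => L (f x)) a b :=
  absolutelyContinuousOnInterval_of_dist_le hf fun _ _ _ _ => L.lipschitz.dist_le_mul _ _

theorem absolutelyContinuousOnInterval_integral {f : ℝ → E} {c : ℝ}
    (hf : IntervalIntegrable f volume a b) (hc : c ∈ uIcc a b) :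
    AbsolutelyContinuousOnInterval (fun x => ∫ t in c..x, f t) a b := by
  refine absolutelyContinuousOnInterval_of_dist_le (C := 1)
    (hf.norm.absolutelyContinuousOnInterval_intervalIntegral hc) fun x hx y hy => ?_
  have hinteg : ∀ z ∈ uIcc a b, IntervalIntegrable f volume c z := fun z hz =>
    hf.mono_set (uIcc_subset_uIcc hc hz)
  rw [one_mul, dist_eq_norm, Real.dist_eq,
    intervalIntegral.integral_interval_sub_left (hinteg x hx) (hinteg y hy),
    intervalIntegral.integral_interval_sub_left (hinteg x hx).norm (hinteg y hy).norm]
  exact intervalIntegral.norm_integral_le_abs_integral_norm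

variable [FiniteDimensional ℝ E] {f f' : ℝ → E}

theorem intervalIntegrable_of_ae_hasDerivAt (hf : AbsolutelyContinuousOnInterval f a b)
    (hderiv : ∀ᵐ x, x ∈ uIcc a b → HasDerivAt f (f' x) x) :
    IntervalIntegrable f' volume a b := by
  let B := Module.finBasis ℝ E
  have hcoord (i) : IntervalIntegrable (fun x => B.coord i (f' x)) volume a b := by
    let L : E →L[ℝ] ℝ := (B.coord i).toContinuousLinearMap
    refine (absolutelyContinuousOnInterval_clm_comp L hf).intervalIntegrable_deriv.congr_ae
      ((ae_restrict_iff' measurableSet_uIoc).2 ?_)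
    filter_upwards [hderiv] with x hx hmem
    exact (L.hasFDerivAt.comp_hasDerivAt x (hx (uIoc_subset_uIcc hmem))).deriv
  refine (IntervalIntegrable.sum Finset.univ fun i _ =>
    (hcoord i).smul_continuousOn (continuousOn_const (c := B i))).congr fun x _ => ?_
  simpa only [Finset.sum_apply, Module.Basis.coord_apply] using B.sum_repr (f' x)

theorem integral_eq_sub_of_ae_hasDerivAt (hf : AbsolutelyContinuousOnInterval f a b)
    (hderiv : ∀ᵐ x, x ∈ uIcc a b → HasDerivAt f (f' x) x) :
    ∫ x in a..b, f' x = f b - f a := by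
  have := FiniteDimensional.complete ℝ E
  have hinteg := intervalIntegrable_of_ae_hasDerivAt hf hderiv
  have hprim := absolutelyContinuousOnInterval_integral hinteg left_mem_uIcc
  obtain ⟨C, hC⟩ := (hf.fun_sub hprim).const_of_ae_hasDerivAt_zero <| by
    filter_upwards [hderiv, hinteg.ae_hasDerivAt_integral] with x hx hx' hmem
    simpa only [sub_self] using (hx hmem).fun_sub (hx' hmem a left_mem_uIcc)
  have hconst := (hC b right_mem_uIcc).trans (hC a left_mem_uIcc).symm
  rw [intervalIntegral.integral_same, sub_zero] at hconst
  rw [← hconst, sub_sub_cancel]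

end AbsolutelyContinuous

section SecondDerivative

variable {E F : Type*} [NormedAddCommGroup E] [NormedSpace ℝ E] [NormedAddCommGroup F]
  [NormedSpace ℝ F] {u u' u'' : ℝ → E} {S T : Set ℝ}

/-- `u''` is the second derivative of `u` on `S` in the sense of Carathéodory: `u` and its
derivative `u'` are absolutely continuous on the compact intervals contained in `S`, and the
derivatives exist almost everywhere on `S`. -/
structure HasACDeriv2On (u u' u'' : ℝ → E) (S : Set ℝ) : Prop where
  ac {x y : ℝ} : uIcc x y ⊆ S → AbsolutelyContinuousOnInterval u x y
  ac_deriv {x y : ℝ} : uIcc x y ⊆ S → AbsolutelyContinuousOnInterval u' x y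
  ae_hasDerivAt : ∀ᵐ x, x ∈ S → HasDerivAt u (u' x) x
  ae_hasDerivAt_deriv : ∀ᵐ x, x ∈ S → HasDerivAt u' (u'' x) x

namespace HasACDeriv2On

theorem of_contDiff (hu : ContDiff ℝ 2 u) : HasACDeriv2On u (deriv u) (deriv (deriv u)) S := by
  have hu' : ContDiff ℝ 1 (deriv u) :=
    ContDiff.deriv' (by simpa only [one_add_one_eq_two] using hu)
  exact
    { ac := fun _ => (hu.of_le one_le_two).contDiffOn.absolutelyContinuousOnInterval
      ac_deriv := fun _ => hu'.contDiffOn.absolutelyContinuousOnInterval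
      ae_hasDerivAt := .of_forall fun x _ => (hu.differentiable two_ne_zero x).hasDerivAt
      ae_hasDerivAt_deriv := .of_forall fun x _ =>
        (hu'.differentiable one_ne_zero x).hasDerivAt }

theorem mono (hu : HasACDeriv2On u u' u'' S) (hTS : T ⊆ S) : HasACDeriv2On u u' u'' T where
  ac h := hu.ac (h.trans hTS)
  ac_deriv h := hu.ac_deriv (h.trans hTS)
  ae_hasDerivAt := hu.ae_hasDerivAt.mono fun _ h hx => h (hTS hx)
  ae_hasDerivAt_deriv := hu.ae_hasDerivAt_deriv.mono fun _ h hx => h (hTS hx)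

theorem clm_comp (L : E →L[ℝ] F) (hu : HasACDeriv2On u u' u'' S) :
    HasACDeriv2On (fun x => L (u x)) (fun x => L (u' x)) (fun x => L (u'' x)) S where
  ac h := absolutelyContinuousOnInterval_clm_comp L (hu.ac h)
  ac_deriv h := absolutelyContinuousOnInterval_clm_comp L (hu.ac_deriv h)
  ae_hasDerivAt := hu.ae_hasDerivAt.mono fun x h hx => L.hasFDerivAt.comp_hasDerivAt x (h hx)
  ae_hasDerivAt_deriv :=
    hu.ae_hasDerivAt_deriv.mono fun x h hx => L.hasFDerivAt.comp_hasDerivAt x (h hx)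

theorem affine_add (hu : HasACDeriv2On u u' u'' S) (c d : E) :
    HasACDeriv2On (fun x => c + x • d + u x) (fun x => d + u' x) u'' S where
  ac h := (ContDiff.contDiffOn (by fun_prop)).absolutelyContinuousOnInterval.fun_add (hu.ac h)
  ac_deriv h := contDiffOn_const.absolutelyContinuousOnInterval.fun_add (hu.ac_deriv h)
  ae_hasDerivAt := hu.ae_hasDerivAt.mono fun x h hx =>
    (((hasDerivAt_id' x).smul_const d).const_add c |>.fun_add (h hx)).congr_deriv
      (by rw [one_smul])
  ae_hasDerivAt_deriv := hu.ae_hasDerivAt_deriv.mono fun x h hx => (h hx).const_add d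

theorem iterated_integral [CompleteSpace E] {f : ℝ → E} (hf : LocallyIntegrable f) :
    HasACDeriv2On (fun x => ∫ s in (0 : ℝ)..x, ∫ t in (0 : ℝ)..s, f t)
      (fun x => ∫ t in (0 : ℝ)..x, f t) f S := by
  have hinteg (a b : ℝ) : IntervalIntegrable f volume a b :=
    (hf.integrableOn_isCompact isCompact_uIcc).intervalIntegrable
  have hcont : Continuous fun x => ∫ t in (0 : ℝ)..x, f t :=
    intervalIntegral.continuous_primitive hinteg 0
  have hderiv (x : ℝ) := hcont.integral_hasStrictDerivAt 0 x
  have hcontDiff : ContDiff ℝ 1 fun x => ∫ s in (0 : ℝ)..x, ∫ t in (0 : ℝ)..s, f t :=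
    contDiff_one_iff_deriv.2 ⟨fun x => (hderiv x).hasDerivAt.differentiableAt,
      hcont.congr fun x => (hderiv x).hasDerivAt.deriv.symm⟩
  refine
    { ac := fun _ => hcontDiff.contDiffOn.absolutelyContinuousOnInterval
      ac_deriv := @fun x y _ => ?_
      ae_hasDerivAt := .of_forall fun x _ => (hderiv x).hasDerivAt
      ae_hasDerivAt_deriv := ?_ }
  · refine absolutelyContinuousOnInterval_of_dist_le (C := 1)
      (absolutelyContinuousOnInterval_integral (hinteg x y) left_mem_uIcc) fun s _ t _ => ?_
    rw [one_mul, dist_eq_norm, dist_eq_norm,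
      intervalIntegral.integral_interval_sub_left (hinteg _ _) (hinteg _ _),
      intervalIntegral.integral_interval_sub_left (hinteg _ _) (hinteg _ _)]
  · filter_upwards [LocallyIntegrable.ae_hasDerivAt_integral hf] with x hx _ using hx 0

theorem hasDerivAt [FiniteDimensional ℝ E] (hu : HasACDeriv2On u u' u'' S) {x : ℝ}
    (hx : S ∈ nhds x) : HasDerivAt u (u' x) x := by
  have := FiniteDimensional.complete ℝ E
  obtain ⟨ε, hε, hball⟩ := Metric.nhds_basis_closedBall.mem_iff.1 hx
  rw [Real.closedBall_eq_Icc, ← uIcc_of_le (by linarith)] at hball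
  have hnhds : [[x - ε, x + ε]] ∈ nhds x := by
    rw [uIcc_of_le (by linarith)]
    exact Icc_mem_nhds (by linarith) (by linarith)
  have hxmem : x ∈ [[x - ε, x + ε]] := mem_of_mem_nhds hnhds
  have hcont : ContinuousOn u' [[x - ε, x + ε]] := (hu.ac_deriv hball).continuousOn
  have hprim : HasDerivAt (fun y => ∫ t in x..y, u' t) (u' x) x :=
    intervalIntegral.integral_hasDerivAt_right IntervalIntegrable.refl
      (hcont.stronglyMeasurableAtFilter_nhdsWithin measurableSet_uIcc x |>.filter_mono
        (nhdsWithin_eq_nhds.2 hnhds).ge) (hcont.continuousAt hnhds)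
  refine (hprim.const_add (u x)).congr_of_eventuallyEq ?_
  filter_upwards [hnhds] with y hy
  have hsub : [[x, y]] ⊆ S := (uIcc_subset_uIcc hxmem hy).trans hball
  rw [integral_eq_sub_of_ae_hasDerivAt (hu.ac hsub)
    (hu.ae_hasDerivAt.mono fun t ht hmem => ht (hsub hmem)), add_sub_cancel]

theorem lagrange_identity {𝕜 : Type*} [RCLike 𝕜] {u u' u'' v v' v'' : ℝ → 𝕜}
    (hu : HasACDeriv2On u u' u'' S) (hv : HasACDeriv2On v v' v'' S)
    {x y : ℝ} (hxy : uIcc x y ⊆ S) :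
    ∫ t in x..y, (u t * v'' t - u'' t * v t) =
      (u y * v' y - u' y * v y) - (u x * v' x - u' x * v x) := by
  refine integral_eq_sub_of_ae_hasDerivAt (f := fun t => u t * v' t - u' t * v t)
    (((hu.ac hxy).fun_smul (hv.ac_deriv hxy)).fun_sub
      ((hu.ac_deriv hxy).fun_smul (hv.ac hxy))) ?_
  filter_upwards [hu.ae_hasDerivAt, hu.ae_hasDerivAt_deriv, hv.ae_hasDerivAt,
    hv.ae_hasDerivAt_deriv] with t hu₀ hu₁ hv₀ hv₁ ht
  have ht := hxy ht
  refine (((hu₀ ht).fun_mul (hv₁ ht)).fun_sub ((hu₁ ht).fun_mul (hv₀ ht))).congr_deriv ?_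
  ring

end HasACDeriv2On

end SecondDerivative

section Decay

variable {E : Type*} [NormedAddCommGroup E]

theorem tendsto_intervalIntegral_add_one_cocompact [NormedSpace ℝ E] {f : ℝ → E}
    (hf : Integrable f) :
    Tendsto (fun x => ∫ t in x..x + 1, f t) (cocompact ℝ) (nhds 0) := by
  have hshift {l : Filter ℝ} {a : ℝ} {I : E} (hl : Tendsto (· + 1) l l)
      (hI : Tendsto (fun x => ∫ t in a..x, f t) l (nhds I)) :
      Tendsto (fun x => ∫ t in x..x + 1, f t) l (nhds 0) := by
    rw [← sub_self I]
    exact ((hI.comp hl).sub hI).congr fun x =>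
      intervalIntegral.integral_interval_sub_left hf.intervalIntegrable hf.intervalIntegrable
  rw [cocompact_eq_atBot_atTop, tendsto_sup]
  exact ⟨hshift (tendsto_atBot_add_const_right _ 1 tendsto_id)
      ((intervalIntegral_tendsto_integral_Iic 0 hf.integrableOn tendsto_id).neg.congr fun x =>
        (intervalIntegral.integral_symm _ _).symm),
    hshift (tendsto_atTop_add_const_right _ 1 tendsto_id)
      (intervalIntegral_tendsto_integral_Ioi 0 hf.integrableOn tendsto_id)⟩

theorem tendsto_intervalIntegral_norm_add_one_cocompact {f : ℝ → E} (hf : MemLp f 2) :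
    Tendsto (fun x => ∫ t in x..x + 1, ‖f t‖) (cocompact ℝ) (nhds 0) := by
  have hsq := (tendsto_intervalIntegral_add_one_cocompact
    (hf.integrable_norm_pow two_ne_zero)).sqrt
  rw [Real.sqrt_zero] at hsq
  refine squeeze_zero (fun x => intervalIntegral.integral_nonneg (by linarith)
    fun _ _ => norm_nonneg _) (fun x => Real.le_sqrt_of_sq_le ?_) hsq
  rw [intervalIntegral.integral_of_le (by linarith), intervalIntegral.integral_of_le (by linarith)]
  have : IsProbabilityMeasure (volume.restrict (Ioc x (x + 1))) := ⟨by simp⟩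
  have hfx := hf.restrict (Ioc x (x + 1))
  exact (even_two.convexOn_pow (𝕜 := ℝ)).map_integral_le (continuous_pow 2).continuousOn
    isClosed_univ (.of_forall fun _ => mem_univ _) (hfx.integrable one_le_two).norm
    (hfx.integrable_norm_pow two_ne_zero)

theorem tendsto_intervalIntegral_norm_add_one {f : ℝ → E} {S : Set ℝ} {l : Filter ℝ}
    (hS : MeasurableSet S) (hf : MemLp f 2 (volume.restrict S)) (hl : l ≤ cocompact ℝ)
    (hlS : ∀ᶠ x in l, uIcc x (x + 1) ⊆ S) :
    Tendsto (fun x => ∫ t in x..x + 1, ‖f t‖) l (nhds 0) := by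
  have hindicator : MemLp (S.indicator f) 2 := (memLp_indicator_iff_restrict hS).2 hf
  refine ((tendsto_intervalIntegral_norm_add_one_cocompact hindicator).mono_left hl).congr' ?_
  filter_upwards [hlS] with x hx
  exact intervalIntegral.integral_congr fun t ht => congrArg norm (indicator_of_mem (hx ht) f)

variable {𝕜 : Type*} [RCLike 𝕜]

/-- Lagrange's identity against a weight `p` that vanishes to second order at the far end of the
window `[x, x + 1]` recovers the boundary data of `u` at `x`. -/
theorem exists_norm_weighted_boundary_le {p : ℝ → ℝ} (hp : ContDiff ℝ 2 p) (hp₁ : p 1 = 0)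
    (hp₁' : deriv p 1 = 0) :
    ∃ C, ∀ (u u' u'' : ℝ → 𝕜) (x : ℝ), HasACDeriv2On u u' u'' (uIcc x (x + 1)) →
      ‖p 0 * u' x - deriv p 0 * u x‖ ≤
        C * ((∫ t in x..x + 1, ‖u t‖) + ∫ t in x..x + 1, ‖u'' t‖) := by
  have hp' : ContDiff ℝ 1 (deriv p) :=
    ContDiff.deriv' (by simpa only [one_add_one_eq_two] using hp)
  obtain ⟨A, hA⟩ := (isCompact_Icc (a := (0 : ℝ)) (b := 1)).exists_bound_of_continuousOn
    hp.continuous.continuousOn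
  obtain ⟨B, hB⟩ := (isCompact_Icc (a := (0 : ℝ)) (b := 1)).exists_bound_of_continuousOn
    (hp'.continuous_deriv le_rfl).continuousOn
  refine ⟨max A B, fun u u' u'' x hu => ?_⟩
  have hweight := (HasACDeriv2On.of_contDiff (S := uIcc x (x + 1))
    (u := fun t => p (t - x)) (hp.comp (by fun_prop))).clm_comp (RCLike.ofRealCLM (K := 𝕜))
  have hderiv (q : ℝ → ℝ) : deriv (fun t => q (t - x)) = fun t => deriv q (t - x) :=
    funext fun t => deriv_comp_sub_const q x t
  have hlagrange := hweight.lagrange_identity hu Subset.rfl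
  simp only [hderiv, RCLike.ofRealCLM_apply, add_sub_cancel_left, sub_self, hp₁,
    hp₁', RCLike.ofReal_zero, zero_mul, zero_sub] at hlagrange
  have hinteg : IntervalIntegrable u volume x (x + 1) :=
    (hu.ac Subset.rfl).continuousOn.intervalIntegrable
  have hinteg'' : IntervalIntegrable u'' volume x (x + 1) :=
    intervalIntegrable_of_ae_hasDerivAt (hu.ac_deriv Subset.rfl) hu.ae_hasDerivAt_deriv
  rw [← norm_neg, ← hlagrange, ← intervalIntegral.integral_add hinteg.norm hinteg''.norm,
    ← intervalIntegral.integral_const_mul]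
  refine intervalIntegral.norm_integral_le_of_norm_le (by linarith) (.of_forall fun t ht => ?_)
    ((hinteg.norm.add hinteg''.norm).const_mul _)
  have ht₀₁ : t - x ∈ Icc (0 : ℝ) 1 := ⟨by linarith [ht.1], by linarith [ht.2]⟩
  calc ‖(p (t - x) : 𝕜) * u'' t - (deriv (deriv p) (t - x) : ℝ) * u t‖
      ≤ ‖p (t - x)‖ * ‖u'' t‖ + ‖deriv (deriv p) (t - x)‖ * ‖u t‖ := by
        grw [norm_sub_le, norm_mul, norm_mul, RCLike.norm_ofReal, RCLike.norm_ofReal,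
          Real.norm_eq_abs, Real.norm_eq_abs]
    _ ≤ max A B * ‖u'' t‖ + max A B * ‖u t‖ := by
        gcongr
        exacts [(hA _ ht₀₁).trans (le_max_left A B), (hB _ ht₀₁).trans (le_max_right A B)]
    _ = max A B * (‖u t‖ + ‖u'' t‖) := by ring

end Decay

namespace HasACDeriv2On

variable {𝕜 : Type*} [RCLike 𝕜] {u u' u'' v v' v'' : ℝ → 𝕜} {S : Set ℝ} {l : Filter ℝ} {a : ℝ}

theorem tendsto_weighted_boundary_zero {p : ℝ → ℝ} (hp : ContDiff ℝ 2 p) (hp₁ : p 1 = 0)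
    (hp₁' : deriv p 1 = 0) (hu : HasACDeriv2On u u' u'' S) (hS : MeasurableSet S)
    (hmem : MemLp u 2 (volume.restrict S)) (hmem'' : MemLp u'' 2 (volume.restrict S))
    (hl : l ≤ cocompact ℝ) (hlS : ∀ᶠ x in l, uIcc x (x + 1) ⊆ S) :
    Tendsto (fun x => p 0 * u' x - deriv p 0 * u x) l (nhds 0) := by
  obtain ⟨C, hC⟩ := exists_norm_weighted_boundary_le (𝕜 := 𝕜) hp hp₁ hp₁'
  have hbound := ((tendsto_intervalIntegral_norm_add_one hS hmem hl hlS).add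
    (tendsto_intervalIntegral_norm_add_one hS hmem'' hl hlS)).const_mul C
  rw [add_zero, mul_zero] at hbound
  refine squeeze_zero_norm' ?_ hbound
  filter_upwards [hlS] with x hx
  exact hC u u' u'' x (hu.mono hx)

theorem tendsto_zero (hu : HasACDeriv2On u u' u'' S) (hS : MeasurableSet S)
    (hmem : MemLp u 2 (volume.restrict S)) (hmem'' : MemLp u'' 2 (volume.restrict S))
    (hl : l ≤ cocompact ℝ) (hlS : ∀ᶠ x in l, uIcc x (x + 1) ⊆ S) :
    Tendsto u l (nhds 0) := by
  have hderiv (x : ℝ) : HasDerivAt (fun t : ℝ => t * (1 - t) ^ 2) ((1 - x) * (1 - 3 * x)) x :=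
    ((hasDerivAt_id' x).mul (((hasDerivAt_id' x).const_sub 1).pow 2)).congr_deriv
      (by simp only [Pi.pow_apply]; ring)
  have h := hu.tendsto_weighted_boundary_zero (by fun_prop) (by norm_num)
    ((hderiv 1).deriv.trans (by norm_num)) hS hmem hmem'' hl hlS
  simpa [(hderiv 0).deriv] using h.neg

theorem deriv_tendsto_zero (hu : HasACDeriv2On u u' u'' S) (hS : MeasurableSet S)
    (hmem : MemLp u 2 (volume.restrict S)) (hmem'' : MemLp u'' 2 (volume.restrict S))
    (hl : l ≤ cocompact ℝ) (hlS : ∀ᶠ x in l, uIcc x (x + 1) ⊆ S) :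
    Tendsto u' l (nhds 0) := by
  have hderiv (x : ℝ) :
      HasDerivAt (fun t : ℝ => (1 + 2 * t) * (1 - t) ^ 2) (-6 * x * (1 - x)) x :=
    ((((hasDerivAt_id' x).const_mul 2).const_add 1).mul
      (((hasDerivAt_id' x).const_sub 1).pow 2)).congr_deriv (by simp only [Pi.pow_apply]; ring)
  have h := hu.tendsto_weighted_boundary_zero (by fun_prop) (by norm_num)
    ((hderiv 1).deriv.trans (by norm_num)) hS hmem hmem'' hl hlS
  simpa [(hderiv 0).deriv] using h

theorem tendsto_wronskian_zero (hu : HasACDeriv2On u u' u'' S) (hv : HasACDeriv2On v v' v'' S)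
    (hS : MeasurableSet S) (hmem : MemLp u 2 (volume.restrict S))
    (hmem'' : MemLp u'' 2 (volume.restrict S)) (hvmem : MemLp v 2 (volume.restrict S))
    (hvmem'' : MemLp v'' 2 (volume.restrict S)) (hl : l ≤ cocompact ℝ)
    (hlS : ∀ᶠ x in l, uIcc x (x + 1) ⊆ S) :
    Tendsto (fun x => u x * v' x - u' x * v x) l (nhds 0) := by
  simpa only [mul_zero, sub_zero] using
    ((hu.tendsto_zero hS hmem hmem'' hl hlS).mul
      (hv.deriv_tendsto_zero hS hvmem hvmem'' hl hlS)).sub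
    ((hu.deriv_tendsto_zero hS hmem hmem'' hl hlS).mul
      (hv.tendsto_zero hS hvmem hvmem'' hl hlS))

theorem integrable_wronskian_deriv {μ : Measure ℝ} (hmem : MemLp u 2 μ) (hmem'' : MemLp u'' 2 μ)
    (hvmem : MemLp v 2 μ) (hvmem'' : MemLp v'' 2 μ) :
    Integrable (fun t => u t * v'' t - u'' t * v t) μ :=
  (hmem.integrable_mul hvmem'').sub (hmem''.integrable_mul hvmem)

theorem lagrange_identity_Ioi (hu : HasACDeriv2On u u' u'' (Ici a))
    (hv : HasACDeriv2On v v' v'' (Ici a)) (hmem : MemLp u 2 (volume.restrict (Ioi a)))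
    (hmem'' : MemLp u'' 2 (volume.restrict (Ioi a))) (hvmem : MemLp v 2 (volume.restrict (Ioi a)))
    (hvmem'' : MemLp v'' 2 (volume.restrict (Ioi a))) :
    ∫ t in Ioi a, (u t * v'' t - u'' t * v t) = -(u a * v' a - u' a * v a) := by
  have hwindow : ∀ᶠ x in atTop, uIcc x (x + 1) ⊆ Ioi a := by
    filter_upwards [eventually_gt_atTop a] with x hx
    rw [uIcc_of_le (by linarith)]
    exact fun t ht => hx.trans_le ht.1
  have hlim := ((hu.mono Ioi_subset_Ici_self).tendsto_wronskian_zero (hv.mono Ioi_subset_Ici_self)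
    measurableSet_Ioi hmem hmem'' hvmem hvmem'' atTop_le_cocompact hwindow).sub_const
    (u a * v' a - u' a * v a)
  rw [zero_sub] at hlim
  refine tendsto_nhds_unique (intervalIntegral_tendsto_integral_Ioi a
    (integrable_wronskian_deriv hmem hmem'' hvmem hvmem'') tendsto_id) (hlim.congr' ?_)
  filter_upwards [eventually_ge_atTop a] with x hx
  refine (hu.lagrange_identity hv ?_).symm
  rw [uIcc_of_le hx]
  exact Icc_subset_Ici_self

theorem lagrange_identity_Iio (hu : HasACDeriv2On u u' u'' (Iic a))
    (hv : HasACDeriv2On v v' v'' (Iic a)) (hmem : MemLp u 2 (volume.restrict (Iio a)))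
    (hmem'' : MemLp u'' 2 (volume.restrict (Iio a))) (hvmem : MemLp v 2 (volume.restrict (Iio a)))
    (hvmem'' : MemLp v'' 2 (volume.restrict (Iio a))) :
    ∫ t in Iio a, (u t * v'' t - u'' t * v t) = u a * v' a - u' a * v a := by
  have hwindow : ∀ᶠ x in atBot, uIcc x (x + 1) ⊆ Iio a := by
    filter_upwards [eventually_lt_atBot (a - 1)] with x hx
    rw [uIcc_of_le (by linarith)]
    exact fun t ht => ht.2.trans_lt (by linarith)
  have hlim := ((hu.mono Iio_subset_Iic_self).tendsto_wronskian_zero (hv.mono Iio_subset_Iic_self)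
    measurableSet_Iio hmem hmem'' hvmem hvmem'' atBot_le_cocompact hwindow).const_sub
    (u a * v' a - u' a * v a)
  rw [sub_zero] at hlim
  have hinteg := integrable_wronskian_deriv hmem hmem'' hvmem hvmem''
  rw [← integral_Iic_eq_integral_Iio]
  refine tendsto_nhds_unique (intervalIntegral_tendsto_integral_Iic a
    ((integrableOn_Iic_iff_integrableOn_Iio (by finiteness)).2 hinteg) tendsto_id) (hlim.congr' ?_)
  filter_upwards [eventually_le_atBot a] with x hx
  refine (hu.lagrange_identity hv ?_).symm
  rw [uIcc_of_le hx]
  exact Icc_subset_Iic_self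

end HasACDeriv2On

section Green

variable {Λ : ℝ} {u v : ℝ → ℂ}

theorem ae_mem_region_of_mem_closedRegion (Λ : ℝ) :
    ∀ᵐ x : ℝ, x ∈ closedRegion Λ → x ∈ region Λ := by
  filter_upwards [Iio_ae_eq_Iic (a := -Λ) (μ := volume), Ioi_ae_eq_Ici (a := Λ) (μ := volume)]
    with x hneg hpos
  exact Or.imp hneg.mpr hpos.mpr

theorem LocAC.absolutelyContinuousOnInterval (hu : LocAC Λ u) {x y : ℝ}
    (hxy : uIcc x y ⊆ closedRegion Λ) : AbsolutelyContinuousOnInterval u x y := by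
  wlog hle : x ≤ y generalizing x y
  · exact (this (uIcc_comm x y ▸ hxy) (le_of_not_ge hle)).symm
  · exact hu x y hle (uIcc_of_le hle ▸ hxy)

theorem IsAC2.hasDerivAt (hu : IsAC2 Λ u) {x : ℝ} (hx : x ∈ region Λ) :
    HasDerivAt u (D Λ u x) x := by
  rw [D_eq_deriv u hx]
  exact ((hu.diff x (region_subset Λ hx)).differentiableAt (closedRegion_mem_nhds hx)).hasDerivAt

theorem IsAC2.hasACDeriv2On (hu : IsAC2 Λ u) :
    HasACDeriv2On u (D Λ u) (D Λ (D Λ u)) (closedRegion Λ) where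
  ac := hu.ac.absolutelyContinuousOnInterval
  ac_deriv := hu.ac_deriv.absolutelyContinuousOnInterval
  ae_hasDerivAt := (ae_mem_region_of_mem_closedRegion Λ).mono fun _ h hx => hu.hasDerivAt (h hx)
  ae_hasDerivAt_deriv := by
    filter_upwards [ae_mem_region_of_mem_closedRegion Λ,
      (ae_restrict_iff' (isOpen_region Λ).measurableSet).1 hu.ac_deriv.ae_differentiableAt]
      with x hmem hdiff hx
    rw [D_eq_deriv _ (hmem hx)]
    exact (hdiff (hmem hx)).hasDerivAt

/-- The sesquilinear form `conj (u x) v'(x) - conj (u'(x)) v(x)`, whose values at `± Λ` are the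
boundary terms of Green's formula. -/
noncomputable def boundaryForm (Λ : ℝ) (u v : ℝ → ℂ) (x : ℝ) : ℂ :=
  conj (u x) * D Λ v x - conj (D Λ u x) * v x

theorem IsAC2.green (hΛ : 0 ≤ Λ) (hu : IsAC2 Λ u) (hv : IsAC2 Λ v)
    (hmem : MemLp u 2 (regionMeasure Λ)) (hvmem : MemLp v 2 (regionMeasure Λ)) :
    ∫ t in region Λ, (conj (u t) * D Λ (D Λ v) t - conj (D Λ (D Λ u) t) * v t) =
      boundaryForm Λ u v (-Λ) - boundaryForm Λ u v Λ := by
  have hconj := hu.hasACDeriv2On.clm_comp (Complex.conjCLE : ℂ →L[ℝ] ℂ)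
  have hdisjoint : Disjoint (Iio (-Λ)) (Ioi Λ) :=
    (Iio_disjoint_Ioi_same (a := Λ)).mono_left (Iio_subset_Iio (by linarith))
  have hrestrict {S : Set ℝ} (hS : S ⊆ region Λ) {f : ℝ → ℂ} (hf : MemLp f 2 (regionMeasure Λ)) :
      MemLp f 2 (volume.restrict S) := hf.mono_measure (Measure.restrict_mono hS le_rfl)
  have hinteg : IntegrableOn
      (fun t => conj (u t) * D Λ (D Λ v) t - conj (D Λ (D Λ u) t) * v t) (region Λ) :=
    HasACDeriv2On.integrable_wronskian_deriv hmem.star hu.memLp_deriv2.star hvmem hv.memLp_deriv2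
  rw [region, setIntegral_union hdisjoint measurableSet_Ioi (hinteg.mono_set subset_union_left)
    (hinteg.mono_set subset_union_right), sub_eq_add_neg]
  congr 1
  · exact (hconj.mono subset_union_left).lagrange_identity_Iio
      (hv.hasACDeriv2On.mono subset_union_left) (hrestrict subset_union_left hmem.star)
      (hrestrict subset_union_left hu.memLp_deriv2.star) (hrestrict subset_union_left hvmem)
      (hrestrict subset_union_left hv.memLp_deriv2)
  · exact (hconj.mono subset_union_right).lagrange_identity_Ioi
      (hv.hasACDeriv2On.mono subset_union_right) (hrestrict subset_union_right hmem.star)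
      (hrestrict subset_union_right hu.memLp_deriv2.star) (hrestrict subset_union_right hvmem)
      (hrestrict subset_union_right hv.memLp_deriv2)

theorem inner_eq_setIntegral {φ ψ : L2 Λ} {f g : ℝ → ℂ} (hφ : φ =ᵐ[regionMeasure Λ] f)
    (hψ : ψ =ᵐ[regionMeasure Λ] g) :
    inner ℂ φ ψ = ∫ x in region Λ, conj (f x) * g x := by
  rw [L2.inner_def]
  refine integral_congr_ae ?_
  filter_upwards [hφ, hψ] with x hφx hψx
  rw [hφx, hψx, RCLike.inner_apply']

theorem negLaplacian_ae_eq (ψ : (negLaplacian Λ).domain) (hu : IsAC2 Λ u)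
    (hψ : (ψ : L2 Λ) =ᵐ[regionMeasure Λ] u) :
    negLaplacian Λ ψ =ᵐ[regionMeasure Λ] -D Λ (D Λ u) :=
  negDeriv2_ae_eq ψ hu hψ

theorem inner_negLaplacian_sub (hΛ : 0 ≤ Λ) {φ ψ : (negLaplacian Λ).domain} (hu : IsAC2 Λ u)
    (hv : IsAC2 Λ v) (hφ : (φ : L2 Λ) =ᵐ[regionMeasure Λ] u)
    (hψ : (ψ : L2 Λ) =ᵐ[regionMeasure Λ] v) :
    inner ℂ (negLaplacian Λ φ) (ψ : L2 Λ) - inner ℂ (φ : L2 Λ) (negLaplacian Λ ψ) =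
      boundaryForm Λ u v (-Λ) - boundaryForm Λ u v Λ := by
  have hmem : MemLp u 2 (regionMeasure Λ) := (Lp.memLp (φ : L2 Λ)).ae_eq hφ
  have hvmem : MemLp v 2 (regionMeasure Λ) := (Lp.memLp (ψ : L2 Λ)).ae_eq hψ
  have hinteg {f g : ℝ → ℂ} (hf : MemLp f 2 (regionMeasure Λ)) (hg : MemLp g 2 (regionMeasure Λ)) :
      Integrable (fun x => conj (f x) * g x) (regionMeasure Λ) := hf.star.integrable_mul hg
  rw [inner_eq_setIntegral (negLaplacian_ae_eq φ hu hφ) hψ,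
    inner_eq_setIntegral hφ (negLaplacian_ae_eq ψ hv hψ), ← hu.green hΛ hv hmem hvmem,
    ← integral_sub (hinteg hu.memLp_deriv2.neg hvmem) (hinteg hmem hv.memLp_deriv2.neg)]
  refine integral_congr_ae (.of_forall fun x => ?_)
  simp only [Pi.neg_apply, map_neg]
  ring

end Green

section TestFunctions

/-- `g` is a real test function on `U`: it is smooth and its support is a compact subset of `U`. -/
structure IsTestFunction (U : Set ℝ) (g : ℝ → ℝ) : Prop where
  contDiff : ContDiff ℝ (⊤ : ℕ∞) g
  hasCompactSupport : HasCompactSupport g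
  tsupport_subset : tsupport g ⊆ U

variable {E : Type*} [NormedAddCommGroup E] [NormedSpace ℝ E] {U V : Set ℝ} {f g : ℝ → ℝ}
  {h : ℝ → E}

namespace IsTestFunction

theorem mono (hg : IsTestFunction U g) (hUV : U ⊆ V) : IsTestFunction V g :=
  ⟨hg.contDiff, hg.hasCompactSupport, hg.tsupport_subset.trans hUV⟩

theorem hasDerivAt (hg : IsTestFunction U g) (x : ℝ) : HasDerivAt g (deriv g x) x :=
  (hg.contDiff.differentiable (by simp) x).hasDerivAt

theorem deriv (hg : IsTestFunction U g) : IsTestFunction U (deriv g) :=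
  ⟨(contDiff_infty_iff_deriv.1 hg.contDiff).2, hg.hasCompactSupport.deriv,
    tsupport_deriv_subset.trans hg.tsupport_subset⟩

theorem sub_const_mul (hf : IsTestFunction U f) (hg : IsTestFunction U g) (c : ℝ) :
    IsTestFunction U fun x => f x - c * g x := by
  have hsupp : (Function.support fun x => c * g x) ⊆ Function.support g :=
    Function.support_const_smul_subset c g
  exact ⟨hf.contDiff.sub (contDiff_const.mul hg.contDiff),
    hf.hasCompactSupport.sub (hg.hasCompactSupport.mono hsupp),
    (tsupport_sub _ _).trans
      (union_subset hf.tsupport_subset ((closure_mono hsupp).trans hg.tsupport_subset))⟩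

theorem integrable (hg : IsTestFunction U g) : Integrable g :=
  hg.contDiff.continuous.integrable_of_hasCompactSupport hg.hasCompactSupport

theorem integrable_smul (hg : IsTestFunction U g) (hh : LocallyIntegrableOn h U) :
    Integrable fun x => g x • h x := by
  refine (integrableOn_iff_integrable_of_support_subset
    ((Function.support_smul_subset_left g h).trans (subset_tsupport g))).1 ?_
  exact (hh.integrableOn_compact_subset hg.tsupport_subset
    hg.hasCompactSupport).continuousOn_smul hg.contDiff.continuous.continuousOn
    hg.hasCompactSupport

theorem exists_integral_eq_one (hU : IsOpen U) (hne : U.Nonempty) :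
    ∃ ρ, IsTestFunction U ρ ∧ ∫ x, ρ x = 1 := by
  obtain ⟨p, hp⟩ := hne
  obtain ⟨ε, hε, hball⟩ := Metric.isOpen_iff.1 hU p hp
  let bump : ContDiffBump p := ⟨ε / 4, ε / 2, by positivity, by linarith⟩
  refine ⟨bump.normed volume, ⟨bump.contDiff_normed, bump.hasCompactSupport_normed, ?_⟩,
    bump.integral_normed⟩
  rw [bump.tsupport_normed_eq]
  exact (Metric.closedBall_subset_ball (half_lt_self hε)).trans hball

theorem exists_deriv_eq_of_integral_eq_zero (hU : U.OrdConnected) (hg : IsTestFunction U g)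
    (hzero : ∫ x, g x = 0) : ∃ G, IsTestFunction U G ∧ _root_.deriv G = g := by
  rcases (tsupport g).eq_empty_or_nonempty with hempty | hne
  · obtain rfl := tsupport_eq_empty_iff.1 hempty
    exact ⟨0, hg, deriv_zero⟩
  obtain ⟨a, ha, hleast⟩ := hg.hasCompactSupport.isCompact.exists_isLeast hne
  obtain ⟨b, hb, hgreatest⟩ := hg.hasCompactSupport.isCompact.exists_isGreatest hne
  have hsupp : Function.support g ⊆ Ioo a b := by
    rw [← interior_Icc]
    exact interior_maximal
      (fun x hx => ⟨hleast (subset_tsupport g hx), hgreatest (subset_tsupport g hx)⟩)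
      hg.contDiff.continuous.isOpen_support
  have hderiv (x : ℝ) := (hg.contDiff.continuous.integral_hasStrictDerivAt a x).hasDerivAt
  have hderiv_eq : (_root_.deriv fun x => ∫ t in a..x, g t) = g :=
    funext fun x => (hderiv x).deriv
  have hprim : (Function.support fun x => ∫ t in a..x, g t) ⊆ Icc a b := by
    refine Function.support_subset_iff'.2 fun x hx => ?_
    rcases lt_or_ge x a with hxa | hax
    · refine intervalIntegral.integral_zero_ae (.of_forall fun t ht => ?_)
      rw [uIoc_of_ge hxa.le] at ht
      exact Function.notMem_support.1 fun hmem => (hsupp hmem).1.not_ge ht.2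
    · have hbx : b ≤ x := (not_le.1 fun hxb => hx ⟨hax, hxb⟩).le
      rw [intervalIntegral.integral_eq_integral_of_support_subset
        (hsupp.trans fun t ht => ⟨ht.1, ht.2.le.trans hbx⟩), hzero]
  refine ⟨_, ⟨contDiff_infty_iff_deriv.2 ⟨fun x => (hderiv x).differentiableAt, ?_⟩,
    .of_support_subset_isCompact isCompact_Icc hprim, (closure_minimal hprim isClosed_Icc).trans
      (hU.out (hg.tsupport_subset ha) (hg.tsupport_subset hb))⟩, hderiv_eq⟩
  rw [hderiv_eq]
  exact hg.contDiff

theorem exists_deriv_eq_sub (hU : U.OrdConnected) (hg : IsTestFunction U g)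
    {ρ : ℝ → ℝ} (hρ : IsTestFunction U ρ) (hone : ∫ x, ρ x = 1) :
    ∃ G, IsTestFunction U G ∧ _root_.deriv G = fun x => g x - (∫ y, g y) * ρ x := by
  refine (hg.sub_const_mul hρ _).exists_deriv_eq_of_integral_eq_zero hU ?_
  rw [integral_sub hg.integrable (hρ.integrable.const_mul _), integral_const_mul, hone, mul_one,
    sub_self]

theorem integral_deriv_mul_id (hg : IsTestFunction U g) :
    ∫ x, _root_.deriv g x * x = -∫ x, g x := by
  have hid : LocallyIntegrableOn (id : ℝ → ℝ) U :=
    continuous_id.locallyIntegrable.locallyIntegrableOn U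
  have hparts := integral_mul_deriv_eq_deriv_mul_of_integrable (u := g) (v := id) (v' := 1)
    (fun x _ => hg.hasDerivAt x) (fun x _ => hasDerivAt_id x)
    (by simpa only [mul_one] using hg.integrable) (hg.deriv.integrable_smul hid)
    (hg.integrable_smul hid)
  simpa only [Pi.one_apply, mul_one, id, eq_neg_iff_add_eq_zero, add_comm] using hparts

theorem integral_deriv_deriv_smul {𝕜 : Type*} [RCLike 𝕜] {p p' p'' : ℝ → 𝕜}
    (hg : IsTestFunction U g) (hp : HasACDeriv2On p p' p'' univ) :
    ∫ x, _root_.deriv (_root_.deriv g) x • p x = ∫ x, g x • p'' x := by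
  obtain ⟨R, hR⟩ := hg.hasCompactSupport.isCompact.isBounded.subset_ball 0
  rw [Real.ball_eq_Ioo, zero_sub, zero_add] at hR
  have hzero {f : ℝ → ℝ} (hf : tsupport f ⊆ tsupport g) {x : ℝ} (hx : x ∉ Ioo (-R) R) : f x = 0 :=
    image_eq_zero_of_notMem_tsupport fun hmem => hx (hR (hf hmem))
  have hderiv : tsupport (_root_.deriv g) ⊆ tsupport g := tsupport_deriv_subset
  have hderiv2 : tsupport (_root_.deriv (_root_.deriv g)) ⊆ tsupport g :=
    tsupport_deriv_subset.trans hderiv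
  have hinterval {f : ℝ → ℝ} (hf : tsupport f ⊆ tsupport g) (q : ℝ → 𝕜) :
      ∫ x, f x • q x = ∫ x in -R..R, f x • q x :=
    (intervalIntegral.integral_eq_integral_of_support_subset
      ((Function.support_smul_subset_left f q).trans fun x hx =>
        Ioo_subset_Ioc_self (not_not.1 fun hmem => hx (hzero hf hmem)))).symm
  have hlagrange := ((HasACDeriv2On.of_contDiff (contDiff_infty.1 hg.contDiff 2)).clm_comp
    RCLike.ofRealCLM).lagrange_identity hp (subset_univ (uIcc (-R) R))
  have hintp'' : IntervalIntegrable p'' volume (-R) R :=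
    intervalIntegrable_of_ae_hasDerivAt (hp.ac_deriv (subset_univ _))
      (hp.ae_hasDerivAt_deriv.mono fun x h _ => h (mem_univ x))
  rw [hinterval hderiv2, hinterval subset_rfl, eq_comm, ← sub_eq_zero,
    ← intervalIntegral.integral_sub
      (hintp''.continuousOn_smul hg.contDiff.continuous.continuousOn)
      ((hg.deriv.deriv.contDiff.continuous.continuousOn.fun_smul
        (hp.ac (subset_univ _)).continuousOn).intervalIntegrable)]
  have hright : R ∉ Ioo (-R) R := fun h => h.2.false
  have hleft : -R ∉ Ioo (-R) R := fun h => h.1.false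
  simpa only [RCLike.ofRealCLM_apply, hzero subset_rfl hright, hzero subset_rfl hleft,
    hzero hderiv hright, hzero hderiv hleft, RCLike.ofReal_zero, zero_mul, sub_zero,
    RCLike.real_smul_eq_coe_mul] using hlagrange

end IsTestFunction

theorem exists_ae_eq_const_of_integral_deriv_smul_eq_zero [CompleteSpace E] (hU : IsOpen U)
    (hconn : U.OrdConnected) (hh : LocallyIntegrableOn h U)
    (hweak : ∀ g, IsTestFunction U g → ∫ x, deriv g x • h x = 0) :
    ∃ c : E, ∀ᵐ x, x ∈ U → h x = c := by
  rcases U.eq_empty_or_nonempty with rfl | hne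
  · exact ⟨0, .of_forall fun _ hx => hx.elim⟩
  obtain ⟨ρ, hρ, hone⟩ := IsTestFunction.exists_integral_eq_one hU hne
  refine ⟨∫ x, ρ x • h x, ?_⟩
  suffices hzero : ∀ᵐ x, x ∈ U → h x - ∫ y, ρ y • h y = 0 from
    hzero.mono fun x hx hmem => sub_eq_zero.1 (hx hmem)
  refine hU.ae_eq_zero_of_integral_contDiff_smul_eq_zero
    (hh.sub ((locallyIntegrable_const _).locallyIntegrableOn U)) fun g hsmooth hcompact hsupp => ?_
  have hg : IsTestFunction U g := ⟨hsmooth, hcompact, hsupp⟩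
  obtain ⟨G, hG, hderiv⟩ := hg.exists_deriv_eq_sub hconn hρ hone
  have hzero := hweak G hG
  simp only [hderiv, sub_smul, mul_smul] at hzero
  rw [integral_sub (hg.integrable_smul hh) ((hρ.integrable_smul hh).fun_smul _),
    integral_smul] at hzero
  simp only [smul_sub]
  rw [integral_sub (hg.integrable_smul hh) (hg.integrable.smul_const _), integral_smul_const,
    hzero]

theorem exists_ae_eq_affine_of_integral_deriv_deriv_smul_eq_zero [CompleteSpace E] (hU : IsOpen U)
    (hconn : U.OrdConnected) (hh : LocallyIntegrableOn h U)
    (hweak : ∀ g, IsTestFunction U g → ∫ x, deriv (deriv g) x • h x = 0) :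
    ∃ c d : E, ∀ᵐ x, x ∈ U → h x = c + x • d := by
  rcases U.eq_empty_or_nonempty with rfl | hne
  · exact ⟨0, 0, .of_forall fun _ hx => hx.elim⟩
  obtain ⟨ρ, hρ, hone⟩ := IsTestFunction.exists_integral_eq_one hU hne
  have hslope (g) (hg : IsTestFunction U g) :
      ∫ x, deriv g x • h x = (∫ x, g x) • ∫ x, deriv ρ x • h x := by
    obtain ⟨G, hG, hderiv⟩ := hg.exists_deriv_eq_sub hconn hρ hone
    have hderiv2 : deriv (deriv G) = fun x => deriv g x - (∫ y, g y) * deriv ρ x := by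
      rw [hderiv]
      exact funext fun x => ((hg.hasDerivAt x).sub ((hρ.hasDerivAt x).const_mul _)).deriv
    have hzero := hweak G hG
    simp only [hderiv2, sub_smul, mul_smul] at hzero
    rwa [integral_sub (hg.deriv.integrable_smul hh) ((hρ.deriv.integrable_smul hh).fun_smul _),
      integral_smul, sub_eq_zero] at hzero
  set d := ∫ x, deriv ρ x • h x
  have hlin : LocallyIntegrableOn (fun x : ℝ => x • d) U :=
    (Continuous.locallyIntegrable (by fun_prop)).locallyIntegrableOn U
  obtain ⟨c, hc⟩ := exists_ae_eq_const_of_integral_deriv_smul_eq_zero hU hconn (hh.add hlin)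
    fun g hg => by
      have hsplit := integral_add (hg.deriv.integrable_smul hh) (hg.deriv.integrable_smul hlin)
      simp only [smul_smul, integral_smul_const, hslope g hg,
        hg.integral_deriv_mul_id, neg_smul, add_neg_cancel] at hsplit
      simpa only [Pi.add_apply, smul_add, smul_smul] using hsplit
  refine ⟨c, -d, hc.mono fun x hx hmem => ?_⟩
  rw [smul_neg, ← sub_eq_add_neg, eq_sub_iff_add_eq]
  exact hx hmem

theorem exists_hasACDeriv2On_of_weak_deriv2 {𝕜 : Type*} [RCLike 𝕜] {v w : ℝ → 𝕜}
    (hU : IsOpen U) (hconn : U.OrdConnected) (hv : LocallyIntegrableOn v U)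
    (hw : LocallyIntegrable w)
    (hweak : ∀ g, IsTestFunction U g → ∫ x, deriv (deriv g) x • v x = ∫ x, g x • w x) :
    ∃ p p', HasACDeriv2On p p' w univ ∧ ∀ᵐ x, x ∈ U → v x = p x := by
  have hprim := HasACDeriv2On.iterated_integral (S := univ) hw
  have hprim_int : LocallyIntegrableOn
      (fun x => ∫ s in (0 : ℝ)..x, ∫ t in (0 : ℝ)..s, w t) U :=
    (continuous_iff_continuousAt.2 fun x =>
      (hprim.hasDerivAt univ_mem).continuousAt).locallyIntegrable.locallyIntegrableOn U
  obtain ⟨c, d, hcd⟩ := exists_ae_eq_affine_of_integral_deriv_deriv_smul_eq_zero hU hconn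
    (hv.sub hprim_int) fun g hg => by
      simp only [Pi.sub_apply, smul_sub]
      rw [integral_sub (hg.deriv.deriv.integrable_smul hv)
        (hg.deriv.deriv.integrable_smul hprim_int), hweak g hg, hg.integral_deriv_deriv_smul hprim,
        sub_self]
  exact ⟨_, _, hprim.affine_add c d, hcd.mono fun x hx hmem => sub_eq_iff_eq_add.1 (hx hmem)⟩

end TestFunctions

section Representatives

variable {Λ : ℝ} {u u' u'' : ℝ → ℂ} {S : Set ℝ}

namespace HasACDeriv2On

theorem piecewise_Iio {E : Type*} [NormedAddCommGroup E] [NormedSpace ℝ E]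
    {p p' p'' r r' r'' : ℝ → E} {c : ℝ} (hp : HasACDeriv2On p p' p'' (Iio c))
    (hr : HasACDeriv2On r r' r'' (Ioi c)) :
    HasACDeriv2On ((Iio c).piecewise p r) ((Iio c).piecewise p' r') ((Iio c).piecewise p'' r'')
      {c}ᶜ := by
  have hside {x y : ℝ} (hxy : uIcc x y ⊆ {c}ᶜ) : uIcc x y ⊆ Iio c ∨ uIcc x y ⊆ Ioi c := by
    have hc {t : ℝ} (ht : t ∈ uIcc x y) : c ∉ uIcc x t := fun hmem =>
      hxy (uIcc_subset_uIcc left_mem_uIcc ht hmem) rfl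
    rcases lt_or_gt_of_ne (hxy left_mem_uIcc) with hx | hx
    · exact .inl fun t ht => not_le.1 fun hct => hc ht (mem_uIcc_of_le hx.le hct)
    · exact .inr fun t ht => not_le.1 fun htc => hc ht (mem_uIcc_of_ge htc hx.le)
  have hac {f g : ℝ → E} {x y : ℝ} (hxy : uIcc x y ⊆ {c}ᶜ)
      (hf : uIcc x y ⊆ Iio c → AbsolutelyContinuousOnInterval f x y)
      (hg : uIcc x y ⊆ Ioi c → AbsolutelyContinuousOnInterval g x y) :
      AbsolutelyContinuousOnInterval ((Iio c).piecewise f g) x y := by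
    rcases hside hxy with h | h
    · exact absolutelyContinuousOnInterval_congr (hf h)
        ((piecewise_eqOn _ f g).symm.mono h)
    · exact absolutelyContinuousOnInterval_congr (hg h)
        ((piecewise_eqOn_compl (Iio c) f g).symm.mono fun t ht => notMem_Iio.2 (h ht).le)
  have hderiv {f f' g g' : ℝ → E} (hf : ∀ᵐ x, x ∈ Iio c → HasDerivAt f (f' x) x)
      (hg : ∀ᵐ x, x ∈ Ioi c → HasDerivAt g (g' x) x) :
      ∀ᵐ x, x ∈ ({c}ᶜ : Set ℝ) →
        HasDerivAt ((Iio c).piecewise f g) ((Iio c).piecewise f' g' x) x := by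
    filter_upwards [hf, hg] with x hfx hgx hx
    rcases lt_or_gt_of_ne hx with h | h
    · rw [piecewise_eq_of_mem _ _ _ (mem_Iio.2 h)]
      exact (hfx h).congr_of_eventuallyEq ((piecewise_eqOn _ f g).eventuallyEq_of_mem
        (Iio_mem_nhds h))
    · rw [piecewise_eq_of_notMem _ _ _ (notMem_Iio.2 h.le)]
      exact (hgx h).congr_of_eventuallyEq
        ((piecewise_eqOn_compl (Iio c) f g).eventuallyEq_of_mem (mem_of_superset (Ioi_mem_nhds h)
          fun t ht => notMem_Iio.2 (le_of_lt ht)))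
  exact
    { ac := fun h => hac h hp.ac hr.ac
      ac_deriv := fun h => hac h hp.ac_deriv hr.ac_deriv
      ae_hasDerivAt := hderiv hp.ae_hasDerivAt hr.ae_hasDerivAt
      ae_hasDerivAt_deriv := hderiv hp.ae_hasDerivAt_deriv hr.ae_hasDerivAt_deriv }

theorem eqOn_D (hu : HasACDeriv2On u u' u'' S) (hS : IsOpen S) (hΛS : closedRegion Λ ⊆ S) :
    EqOn (D Λ u) u' (closedRegion Λ) := fun x hx =>
  (hu.hasDerivAt (hS.mem_nhds (hΛS hx))).hasDerivWithinAt.derivWithin <|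
    hx.elim (fun h => (uniqueDiffOn_Iic _ x h).mono subset_union_left)
      fun h => (uniqueDiffOn_Ici _ x h).mono subset_union_right

theorem D_D_ae_eq (hu : HasACDeriv2On u u' u'' S) (hS : IsOpen S) (hΛS : closedRegion Λ ⊆ S) :
    D Λ (D Λ u) =ᵐ[regionMeasure Λ] u'' := by
  filter_upwards [ae_mem_region Λ, ae_restrict_of_ae hu.ae_hasDerivAt_deriv] with x hx hderiv
  rw [Junction.eqOn_D ((hu.eqOn_D hS hΛS).mono (region_subset Λ)) hx, D_eq_deriv _ hx]
  exact (hderiv (hΛS (region_subset Λ hx))).deriv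

theorem isAC2 (hu : HasACDeriv2On u u' u'' S) (hS : IsOpen S) (hΛS : closedRegion Λ ⊆ S)
    (hmem : MemLp u'' 2 (regionMeasure Λ)) : IsAC2 Λ u where
  ac _ _ hle hxy := hu.ac (uIcc_of_le hle ▸ hxy.trans hΛS)
  diff _ hx := (hu.hasDerivAt (hS.mem_nhds (hΛS hx))).differentiableAt.differentiableWithinAt
  ac_deriv := LocAC.congr
    (fun _ _ hle hxy => hu.ac_deriv (uIcc_of_le hle ▸ hxy.trans hΛS)) (hu.eqOn_D hS hΛS).symm
  memLp_deriv2 := hmem.ae_eq (hu.D_D_ae_eq hS hΛS).symm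

end HasACDeriv2On

theorem closedRegion_subset_compl_zero (hΛ : 0 < Λ) : closedRegion Λ ⊆ {0}ᶜ := by
  rintro x (hx | hx) rfl
  · exact (neg_lt_zero.2 hΛ).not_ge hx
  · exact hΛ.not_ge hx

theorem exists_isAC2_of_weak_deriv2 (hΛ : 0 < Λ) {v w : ℝ → ℂ}
    (hv : MemLp v 2 (regionMeasure Λ)) (hw : MemLp w 2 (regionMeasure Λ))
    (hweak : ∀ g, IsTestFunction (region Λ) g →
      ∫ x in region Λ, deriv (deriv g) x • v x = ∫ x in region Λ, g x • w x) :
    ∃ u, IsAC2 Λ u ∧ v =ᵐ[regionMeasure Λ] u ∧ D Λ (D Λ u) =ᵐ[regionMeasure Λ] w := by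
  have hregion := (isOpen_region Λ).measurableSet
  have hlocal {f : ℝ → ℂ} (hf : MemLp f 2 (regionMeasure Λ)) :
      LocallyIntegrable ((region Λ).indicator f) := by
    have hindicator : MemLp ((region Λ).indicator f) 2 :=
      (memLp_indicator_iff_restrict hregion).2 hf
    exact hindicator.locallyIntegrable one_le_two
  have hweak' (g) (hg : IsTestFunction (region Λ) g) :
      ∫ x, deriv (deriv g) x • (region Λ).indicator v x =
        ∫ x, g x • (region Λ).indicator w x := by
    simpa only [← integral_indicator hregion, indicator_smul] using hweak g hg
  have hcomponent {U : Set ℝ} (hU : IsOpen U) (hconn : U.OrdConnected) (hsub : U ⊆ region Λ) :=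
    exists_hasACDeriv2On_of_weak_deriv2 hU hconn ((hlocal hv).locallyIntegrableOn U) (hlocal hw)
      fun g hg => hweak' g (hg.mono hsub)
  obtain ⟨p, p', hp, hvp⟩ := hcomponent isOpen_Iio ordConnected_Iio subset_union_left
  obtain ⟨r, r', hr, hvr⟩ := hcomponent isOpen_Ioi ordConnected_Ioi subset_union_right
  have hglue := (hp.mono (subset_univ (Iio 0))).piecewise_Iio (hr.mono (subset_univ (Ioi 0)))
  rw [piecewise_same] at hglue
  have hΛS := closedRegion_subset_compl_zero hΛ
  have hindicator : (region Λ).indicator w =ᵐ[regionMeasure Λ] w :=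
    indicator_ae_eq_restrict hregion
  refine ⟨_, hglue.isAC2 isOpen_compl_singleton hΛS (hw.ae_eq hindicator.symm), ?_,
    (hglue.D_D_ae_eq isOpen_compl_singleton hΛS).trans hindicator⟩
  filter_upwards [ae_mem_region Λ, ae_restrict_of_ae hvp, ae_restrict_of_ae hvr]
    with x hx hleft hright
  rw [← indicator_of_mem hx v]
  rcases hx with hx | hx
  · rw [piecewise_eq_of_mem _ _ _ (mem_Iio.2 (lt_trans hx (neg_lt_zero.2 hΛ))), hleft hx]
  · rw [piecewise_eq_of_notMem _ _ _ (notMem_Iio.2 (hΛ.trans hx).le), hright hx]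

end Representatives

theorem domRestrict_mono {R E F : Type*} [Ring R] [AddCommGroup E] [Module R E]
    [AddCommGroup F] [Module R F] {f : E →ₗ.[R] F} {S T : Submodule R E} (hST : S ≤ T) :
    f.domRestrict S ≤ f.domRestrict T :=
  ⟨inf_le_inf_right _ hST, fun _ _ hxy => congrArg f.toFun (Subtype.ext hxy)⟩

section Adjoint

variable {𝕜 E F : Type*} [RCLike 𝕜] [NormedAddCommGroup E] [InnerProductSpace 𝕜 E]
  [CompleteSpace E] [NormedAddCommGroup F] [InnerProductSpace 𝕜 F]

theorem adjoint_le_adjoint {A B : E →ₗ.[𝕜] F} (hA : Dense (A.domain : Set E)) (hAB : A ≤ B) :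
    B.adjoint ≤ A.adjoint := by
  refine LinearPMap.IsFormalAdjoint.le_adjoint hA fun x y => ?_
  rw [hAB.2 (y := ⟨x, hAB.1 x.2⟩) rfl]
  exact (LinearPMap.adjoint_isFormalAdjoint (hA.mono hAB.1)).symm ⟨x, hAB.1 x.2⟩ y

theorem adjoint_adjoint_eq_topologicalClosure [CompleteSpace F] (g : Submodule 𝕜 (E × F)) :
    g.adjoint.adjoint = g.topologicalClosure := by
  let e := WithLp.prodContinuousLinearEquiv 2 𝕜 E F
  let K : Submodule 𝕜 (WithLp 2 (E × F)) := g.comap e.toLinearMap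
  have hK (q : WithLp 2 (E × F)) : q ∈ Kᗮ ↔ (q.snd, -q.fst) ∈ g.adjoint := by
    simp only [Submodule.mem_orthogonal, Submodule.mem_adjoint_iff, inner_neg_right,
      sub_neg_eq_add, WithLp.prod_inner_apply]
    exact ⟨fun h a b hab => (add_comm _ _).trans (h (WithLp.toLp 2 (a, b)) hab),
      fun h p hp => (add_comm _ _).trans (h p.fst p.snd hp)⟩
  have hKK (x : E × F) : x ∈ g.adjoint.adjoint ↔ WithLp.toLp 2 x ∈ Kᗮᗮ := by
    rw [Submodule.mem_orthogonal, Submodule.mem_adjoint_iff]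
    constructor
    · intro h q hq
      have := h _ _ ((hK q).1 hq)
      rw [inner_neg_left] at this
      rw [WithLp.prod_inner_apply]
      exact neg_eq_zero.1 ((neg_add' _ _).trans this)
    · intro h a b hab
      have := h (WithLp.toLp 2 (-b, a)) ((hK _).2 ((neg_neg b).symm ▸ hab))
      rw [WithLp.prod_inner_apply, inner_neg_left] at this
      rw [← neg_eq_zero, neg_sub, sub_eq_neg_add]
      exact this
  ext x
  rw [hKK, Submodule.orthogonal_orthogonal_eq_closure]
  exact (Set.ext_iff.1 (e.toHomeomorph.preimage_closure (g : Set (E × F))) (WithLp.toLp 2 x)).symm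

theorem adjoint_adjoint_eq_closure [CompleteSpace F] {A : E →ₗ.[𝕜] F}
    (hA : Dense (A.domain : Set E)) (hA' : Dense (A.adjoint.domain : Set F)) :
    A.adjoint.adjoint = A.closure := by
  have hclosable : A.IsClosable :=
    (LinearPMap.adjoint_isClosed hA').isClosable.leIsClosable
      ((LinearPMap.adjoint_isFormalAdjoint hA).le_adjoint hA')
  refine LinearPMap.eq_of_eq_graph ?_
  rw [LinearPMap.adjoint_graph_eq_graph_adjoint hA', LinearPMap.adjoint_graph_eq_graph_adjoint hA,
    adjoint_adjoint_eq_topologicalClosure, hclosable.graph_closure_eq_closure_graph]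

theorem adjoint_closure [CompleteSpace F] {A : E →ₗ.[𝕜] F}
    (hA : Dense (A.domain : Set E)) (hA' : Dense (A.adjoint.domain : Set F)) :
    A.closure.adjoint = A.adjoint := by
  refine (adjoint_le_adjoint hA A.le_closure).antisymm ?_
  refine LinearPMap.IsFormalAdjoint.le_adjoint (hA.mono A.le_closure.1) ?_
  rw [← adjoint_adjoint_eq_closure hA hA']
  exact LinearPMap.adjoint_isFormalAdjoint hA'

theorem closure_le_of_isSelfAdjoint {A B : E →ₗ.[𝕜] E} (hA : Dense (A.domain : Set E))
    (hAB : A ≤ B) (hB : IsSelfAdjoint B) : A.closure ≤ B := by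
  have hBA : B ≤ A.adjoint := hB.symm.trans_le (adjoint_le_adjoint hA hAB)
  rw [← adjoint_adjoint_eq_closure hA (hB.dense_domain.mono hBA.1)]
  exact (adjoint_le_adjoint hB.dense_domain hBA).trans_eq hB

theorem isSelfAdjoint_adjoint_domRestrict {A : E →ₗ.[𝕜] E} (hA : Dense (A.domain : Set E))
    (hsymm : A ≤ A.adjoint) {S : Submodule 𝕜 E} (hS : A.domain ≤ S)
    (hmem : ∀ ψ : A.adjoint.domain, (ψ : E) ∈ S ↔ ∀ φ : A.adjoint.domain, (φ : E) ∈ S →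
      inner 𝕜 (A.adjoint φ) (ψ : E) = inner 𝕜 (φ : E) (A.adjoint ψ)) :
    IsSelfAdjoint (A.adjoint.domRestrict S) := by
  set B := A.adjoint.domRestrict S
  have hBapply (φ : A.adjoint.domain) (hφ : (φ : E) ∈ S) : B ⟨φ, hφ, φ.2⟩ = A.adjoint φ :=
    LinearPMap.domRestrict_apply rfl
  have hAB : A ≤ B := ⟨le_inf hS hsymm.1, fun x y hxy =>
    (hsymm.2 (y := ⟨y, y.2.2⟩) hxy).trans (hBapply _ y.2.1).symm⟩
  have hdense : Dense (B.domain : Set E) := hA.mono hAB.1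
  have hBadjoint : B ≤ B.adjoint := by
    refine LinearPMap.IsFormalAdjoint.le_adjoint hdense fun φ ψ => ?_
    exact (hmem ⟨ψ, ψ.2.2⟩).1 ψ.2.1 ⟨φ, φ.2.2⟩ φ.2.1
  refine (LinearPMap.eq_of_le_of_domain_eq hBadjoint (hBadjoint.1.antisymm fun ψ hψ => ?_)).symm
  have hadjoint := adjoint_le_adjoint hA hAB
  refine ⟨(hmem ⟨ψ, hadjoint.1 hψ⟩).2 fun φ hφ => ?_, hadjoint.1 hψ⟩
  rw [← hBapply φ hφ, ← hadjoint.2 (x := ⟨ψ, hψ⟩) rfl]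
  exact (LinearPMap.adjoint_isFormalAdjoint hdense).symm ⟨φ, hφ, φ.2⟩ ⟨ψ, hψ⟩

end Adjoint

section Operators

variable {Λ : ℝ} {u : ℝ → ℂ}

theorem domain_domRestrict_negLaplacian {S : Submodule ℂ (L2 Λ)} (hS : S ≤ maxDomain Λ) :
    ((negLaplacian Λ).domRestrict S).domain = S :=
  inf_eq_left.2 hS

/-- The values of `u` and of its derivative at `-Λ` and at `Λ` all vanish. This is the boundary
condition that singles out the domain of `H0`. -/
def HasZeroBoundaryValues (Λ : ℝ) (u : ℝ → ℂ) : Prop :=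
  ∀ x ∈ ({-Λ, Λ} : Set ℝ), u x = 0 ∧ D Λ u x = 0

theorem HasZeroBoundaryValues.boundaryForm_eq_zero (hu : HasZeroBoundaryValues Λ u)
    (v : ℝ → ℂ) {x : ℝ} (hx : x ∈ ({-Λ, Λ} : Set ℝ)) : boundaryForm Λ u v x = 0 := by
  simp only [boundaryForm, hu x hx, map_zero, zero_mul, sub_zero]

theorem inner_negLaplacian_of_hasZeroBoundaryValues (hΛ : 0 ≤ Λ)
    {φ ψ : (negLaplacian Λ).domain} (hu : IsAC2 Λ u) (hφ : (φ : L2 Λ) =ᵐ[regionMeasure Λ] u)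
    (hzero : HasZeroBoundaryValues Λ u) :
    inner ℂ (negLaplacian Λ φ) (ψ : L2 Λ) = inner ℂ (φ : L2 Λ) (negLaplacian Λ ψ) := by
  obtain ⟨v, hv, hψ⟩ := ψ.2
  rw [← sub_eq_zero, inner_negLaplacian_sub hΛ hu hv hφ hψ,
    hzero.boundaryForm_eq_zero v (by simp), hzero.boundaryForm_eq_zero v (by simp), sub_zero]

theorem isAC2_of_contDiff (hu : ContDiff ℝ 2 u) (hc : HasCompactSupport u) : IsAC2 Λ u :=
  (HasACDeriv2On.of_contDiff hu).isAC2 isOpen_univ (subset_univ _)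
    ((hu.iterate_deriv' 0 2).continuous.memLp_of_hasCompactSupport hc.deriv.deriv)

theorem notMem_region_of_mem_pair (hΛ : 0 ≤ Λ) {x : ℝ} (hx : x ∈ ({-Λ, Λ} : Set ℝ)) :
    x ∉ region Λ := by
  rcases hx with rfl | rfl <;> rintro (h | h) <;> simp only [mem_Iio, mem_Ioi] at h <;> linarith

theorem exists_hasZeroBoundaryValues_of_mem_testSpace (hΛ : 0 ≤ Λ) {φ : L2 Λ}
    (hφ : φ ∈ testSpace Λ) :
    ∃ u, IsAC2 Λ u ∧ φ =ᵐ[regionMeasure Λ] u ∧ HasZeroBoundaryValues Λ u := by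
  obtain ⟨u, hu, hc, hsub, hφu⟩ := hφ
  have hu2 : ContDiff ℝ 2 u := contDiff_infty.1 hu 2
  refine ⟨u, isAC2_of_contDiff hu2 hc, hφu, fun x hx => ?_⟩
  have hxr := notMem_region_of_mem_pair hΛ hx
  have hxc : x ∈ closedRegion Λ := by
    rcases hx with rfl | rfl
    exacts [neg_mem_closedRegion Λ, mem_closedRegion x]
  rw [(HasACDeriv2On.of_contDiff hu2).eqOn_D isOpen_univ (subset_univ _) hxc]
  exact ⟨image_eq_zero_of_notMem_tsupport fun h => hxr (hsub h),
    image_eq_zero_of_notMem_tsupport fun h => hxr (hsub (tsupport_deriv_subset h))⟩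

theorem exists_mem_H00_domain {g : ℝ → ℝ} (hg : IsTestFunction (region Λ) g) :
    ∃ φ : (H00 Λ).domain, (φ : L2 Λ) =ᵐ[regionMeasure Λ] (fun x => (g x : ℂ)) ∧
      H00 Λ φ =ᵐ[regionMeasure Λ] fun x => -((deriv (deriv g) x : ℝ) : ℂ) := by
  set u : ℝ → ℂ := fun x => (g x : ℂ) with hu
  have hsmooth : ContDiff ℝ (⊤ : ℕ∞) u := Complex.ofRealCLM.contDiff.comp hg.contDiff
  have hc : HasCompactSupport u := hg.hasCompactSupport.comp_left Complex.ofReal_zero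
  have hsub : tsupport u ⊆ region Λ := by
    refine (closure_mono fun x hx => ?_).trans hg.tsupport_subset
    exact fun hgx => hx (Complex.ofReal_eq_zero.2 hgx)
  have hmem : MemLp u 2 (regionMeasure Λ) := hsmooth.continuous.memLp_of_hasCompactSupport hc
  have htest : hmem.toLp u ∈ testSpace Λ := ⟨u, hsmooth, hc, hsub, hmem.coeFn_toLp⟩
  have hu2 : ContDiff ℝ 2 u := contDiff_infty.1 hsmooth 2
  have hderiv {f : ℝ → ℝ} (hf : IsTestFunction (region Λ) f) :
      deriv (fun x => (f x : ℂ)) = fun x => ((deriv f x : ℝ) : ℂ) :=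
    funext fun x => (hf.hasDerivAt x).ofReal_comp.deriv
  refine ⟨⟨hmem.toLp u, htest, testSpace_le_maxDomain Λ htest⟩, hmem.coeFn_toLp, ?_⟩
  have hD := (HasACDeriv2On.of_contDiff hu2).D_D_ae_eq isOpen_univ (subset_univ (closedRegion Λ))
  rw [hu, hderiv hg, hderiv hg.deriv] at hD
  exact (negLaplacian_ae_eq _ (isAC2_of_contDiff hu2 hc) hmem.coeFn_toLp).trans hD.neg

theorem dense_H00_domain (Λ : ℝ) : Dense ((H00 Λ).domain : Set (L2 Λ)) := by
  rw [Submodule.dense_iff_topologicalClosure_eq_top, Submodule.topologicalClosure_eq_top_iff,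
    Submodule.eq_bot_iff]
  intro ψ hψ
  have hindicator : MemLp ((region Λ).indicator ψ) 2 :=
    (memLp_indicator_iff_restrict (isOpen_region Λ).measurableSet).2 (Lp.memLp ψ)
  have hzero := (isOpen_region Λ).ae_eq_zero_of_integral_contDiff_smul_eq_zero (μ := volume)
    ((hindicator.locallyIntegrable one_le_two).locallyIntegrableOn _) fun g hg hc hsub => ?_
  · rw [Lp.eq_zero_iff_ae_eq_zero]
    filter_upwards [ae_mem_region Λ, ae_restrict_of_ae hzero] with x hx h
    rw [← indicator_of_mem hx ψ, h hx, Pi.zero_apply]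
  · obtain ⟨φ, hφ, -⟩ := exists_mem_H00_domain ⟨hg, hc, hsub⟩
    have horth := (Submodule.mem_orthogonal _ _).1 hψ φ φ.2
    rw [inner_eq_setIntegral hφ EventuallyEq.rfl] at horth
    rw [← indicator_smul, integral_indicator (isOpen_region Λ).measurableSet]
    simpa only [Complex.conj_ofReal, Complex.real_smul] using horth

theorem H00_adjoint_domain_le (hΛ : 0 < Λ) : (H00 Λ).adjoint.domain ≤ maxDomain Λ := by
  intro ψ hψ
  set χ := (H00 Λ).adjoint ⟨ψ, hψ⟩
  have hweak (g) (hg : IsTestFunction (region Λ) g) :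
      ∫ x in region Λ, deriv (deriv g) x • ψ x = ∫ x in region Λ, g x • (-χ x) := by
    obtain ⟨φ, hφ, hHφ⟩ := exists_mem_H00_domain hg
    have h := (LinearPMap.adjoint_isFormalAdjoint (dense_H00_domain Λ)).symm φ ⟨ψ, hψ⟩
    rw [inner_eq_setIntegral hφ EventuallyEq.rfl, inner_eq_setIntegral hHφ EventuallyEq.rfl] at h
    simp only [map_neg, Complex.conj_ofReal, neg_mul, integral_neg] at h
    simp only [smul_neg, integral_neg, Complex.real_smul]
    exact neg_eq_iff_eq_neg.1 h
  obtain ⟨u, hu, hψu, -⟩ := exists_isAC2_of_weak_deriv2 hΛ (Lp.memLp ψ) (Lp.memLp χ).neg hweak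
  exact ⟨u, hu, hψu⟩

theorem H00_adjoint_eq (hΛ : 0 < Λ) : (H00 Λ).adjoint = negLaplacian Λ := by
  have hle : negLaplacian Λ ≤ (H00 Λ).adjoint := by
    refine LinearPMap.IsFormalAdjoint.le_adjoint (dense_H00_domain Λ) fun φ ψ => ?_
    obtain ⟨u, hu, hφu, hzero⟩ := exists_hasZeroBoundaryValues_of_mem_testSpace hΛ.le φ.2.1
    exact inner_negLaplacian_of_hasZeroBoundaryValues hΛ.le (φ := ⟨φ, φ.2.2⟩) hu hφu hzero
  exact (LinearPMap.eq_of_le_of_domain_eq hle (hle.1.antisymm (H00_adjoint_domain_le hΛ))).symm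

theorem dense_maxDomain (Λ : ℝ) : Dense (maxDomain Λ : Set (L2 Λ)) :=
  (dense_H00_domain Λ).mono fun _ hφ => hφ.2

theorem H0_adjoint_eq (hΛ : 0 < Λ) : (H0 Λ).adjoint = negLaplacian Λ := by
  rw [H0, adjoint_closure (dense_H00_domain Λ) ?_, H00_adjoint_eq hΛ]
  exact H00_adjoint_eq hΛ ▸ dense_maxDomain Λ

theorem negLaplacian_adjoint_eq (hΛ : 0 < Λ) : (negLaplacian Λ).adjoint = H0 Λ := by
  rw [← H00_adjoint_eq hΛ, H0, adjoint_adjoint_eq_closure (dense_H00_domain Λ)]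
  exact H00_adjoint_eq hΛ ▸ dense_maxDomain Λ

theorem mem_H0_domain_of_hasZeroBoundaryValues (hΛ : 0 < Λ) {ψ : L2 Λ} (hu : IsAC2 Λ u)
    (hψ : ψ =ᵐ[regionMeasure Λ] u) (hzero : HasZeroBoundaryValues Λ u) : ψ ∈ (H0 Λ).domain := by
  have hmem : ψ ∈ (negLaplacian Λ).domain := ⟨u, hu, hψ⟩
  rw [← negLaplacian_adjoint_eq hΛ]
  exact LinearPMap.mem_adjoint_domain_of_exists _ ⟨negLaplacian Λ ⟨ψ, hmem⟩, fun φ =>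
    inner_negLaplacian_of_hasZeroBoundaryValues hΛ.le (φ := ⟨ψ, hmem⟩) hu hψ hzero⟩

theorem isSelfAdjointExtension_domRestrict (hΛ : 0 < Λ) {S : Submodule ℂ (L2 Λ)}
    (hS : testSpace Λ ≤ S)
    (hmem : ∀ ψ : (negLaplacian Λ).domain, (ψ : L2 Λ) ∈ S ↔
      ∀ φ : (negLaplacian Λ).domain, (φ : L2 Λ) ∈ S →
        inner ℂ (negLaplacian Λ φ) (ψ : L2 Λ) = inner ℂ (φ : L2 Λ) (negLaplacian Λ ψ)) :
    IsSelfAdjointExtension (H0 Λ) ((negLaplacian Λ).domRestrict S) := by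
  have hsymm : H00 Λ ≤ (H00 Λ).adjoint := H00_adjoint_eq hΛ ▸ LinearPMap.domRestrict_le
  have hself : IsSelfAdjoint ((negLaplacian Λ).domRestrict S) := by
    rw [← H00_adjoint_eq hΛ] at hmem ⊢
    exact isSelfAdjoint_adjoint_domRestrict (dense_H00_domain Λ) hsymm
      (fun _ hφ => hS hφ.1) hmem
  exact ⟨closure_le_of_isSelfAdjoint (dense_H00_domain Λ) (domRestrict_mono hS) hself, hself⟩

end Operators

section BoundaryValues

variable {Λ : ℝ} {k m : ℂ}

theorem hasDerivAt_const_mul_cexp (A k : ℂ) (x : ℝ) :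
    HasDerivAt (fun x : ℝ => A * Complex.exp (k * x)) (A * k * Complex.exp (k * x)) x := by
  have hlin : HasDerivAt (fun x : ℝ => k * (x : ℂ)) k x := by
    simpa only [Complex.ofReal_one, mul_one] using (hasDerivAt_id' x).ofReal_comp.const_mul k
  exact (hlin.cexp.const_mul A).congr_deriv (by ring)

theorem hasACDeriv2On_const_mul_cexp (A k : ℂ) (S : Set ℝ) :
    HasACDeriv2On (fun x : ℝ => A * Complex.exp (k * x))
      (fun x : ℝ => A * k * Complex.exp (k * x)) (fun x : ℝ => A * k * k * Complex.exp (k * x))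
      S := by
  have hderiv (A : ℂ) : deriv (fun x : ℝ => A * Complex.exp (k * x)) =
      fun x : ℝ => A * k * Complex.exp (k * x) :=
    funext fun x => (hasDerivAt_const_mul_cexp A k x).deriv
  have hsmooth : ContDiff ℝ 2 fun x : ℝ => A * Complex.exp (k * x) :=
    contDiff_const.mul (contDiff_const.mul Complex.ofRealCLM.contDiff).cexp
  simpa only [hderiv] using HasACDeriv2On.of_contDiff (S := S) hsmooth

/-- The function equal to `A e^{kx}` on the left half-line and to `B e^{-mx}` on the right one.
For exponents with positive real part it decays at both ends. The gluing point `0` lies inside the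
junction, so the jump there is immaterial. -/
noncomputable def gluedExp (A k B m : ℂ) : ℝ → ℂ :=
  (Iio 0).piecewise (fun x => A * Complex.exp (k * x)) (fun x => B * Complex.exp (-m * x))

theorem gluedExp_of_neg {x : ℝ} (hx : x < 0) (A k B m : ℂ) :
    gluedExp A k B m x = A * Complex.exp (k * x) :=
  piecewise_eq_of_mem _ _ _ hx

theorem gluedExp_of_pos {x : ℝ} (hx : 0 < x) (A k B m : ℂ) :
    gluedExp A k B m x = B * Complex.exp (-m * x) :=
  piecewise_eq_of_notMem _ _ _ (notMem_Iio.2 hx.le)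

theorem gluedExp_neg_apply (hΛ : 0 < Λ) (A k B m : ℂ) :
    gluedExp A k B m (-Λ) = A * Complex.exp (-k * Λ) := by
  rw [gluedExp_of_neg (neg_lt_zero.2 hΛ), Complex.ofReal_neg, neg_mul_comm]

theorem hasACDeriv2On_gluedExp (A k B m : ℂ) :
    HasACDeriv2On (gluedExp A k B m) (gluedExp (A * k) k (B * -m) m)
      (gluedExp (A * k * k) k (B * -m * -m) m) {0}ᶜ :=
  (hasACDeriv2On_const_mul_cexp A k _).piecewise_Iio (hasACDeriv2On_const_mul_cexp B (-m) _)

theorem memLp_gluedExp (hΛ : 0 < Λ) (hk : 0 < k.re) (hm : 0 < m.re) (A B : ℂ) :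
    MemLp (gluedExp A k B m) 2 (regionMeasure Λ) := by
  have hmeas : Measurable (gluedExp A k B m) :=
    Measurable.piecewise measurableSet_Iio (by fun_prop) (by fun_prop)
  have hnorm (A k : ℂ) (x : ℝ) :
      ‖A * Complex.exp (k * x)‖ ^ 2 = ‖A‖ ^ 2 * Real.exp (2 * k.re * x) := by
    rw [norm_mul, mul_pow, Complex.norm_exp, ← Real.exp_nat_mul, Complex.re_mul_ofReal]
    push_cast
    ring_nf
  rw [memLp_two_iff_integrable_sq_norm hmeas.aestronglyMeasurable]
  refine IntegrableOn.union ?_ ?_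
  · have hinteg := (integrableOn_exp_mul_Iic (mul_pos two_pos hk) (-Λ)).const_mul (‖A‖ ^ 2)
    refine IntegrableOn.congr_fun (IntegrableOn.mono_set hinteg Iio_subset_Iic_self)
      (fun x hx => ?_) measurableSet_Iio
    rw [gluedExp_of_neg (lt_trans hx (neg_lt_zero.2 hΛ)), hnorm]
  · have hre : 2 * (-m).re < 0 := by
      rw [Complex.neg_re]
      linarith
    have hinteg := (integrableOn_exp_mul_Ioi hre Λ).const_mul (‖B‖ ^ 2)
    refine IntegrableOn.congr_fun hinteg (fun x hx => ?_) measurableSet_Ioi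
    rw [gluedExp_of_pos (hΛ.trans hx), hnorm]

theorem isAC2_gluedExp (hΛ : 0 < Λ) (hk : 0 < k.re) (hm : 0 < m.re) (A B : ℂ) :
    IsAC2 Λ (gluedExp A k B m) :=
  (hasACDeriv2On_gluedExp A k B m).isAC2 isOpen_compl_singleton (closedRegion_subset_compl_zero hΛ)
    (memLp_gluedExp hΛ hk hm _ _)

theorem D_gluedExp (hΛ : 0 < Λ) (A k B m : ℂ) :
    EqOn (D Λ (gluedExp A k B m)) (gluedExp (A * k) k (B * -m) m) (closedRegion Λ) :=
  (hasACDeriv2On_gluedExp A k B m).eqOn_D isOpen_compl_singleton (closedRegion_subset_compl_zero hΛ)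

theorem exists_isAC2_boundary_values (hΛ : 0 < Λ) (a a' b b' : ℂ) :
    ∃ u, IsAC2 Λ u ∧ MemLp u 2 (regionMeasure Λ) ∧ u (-Λ) = a ∧ D Λ u (-Λ) = a' ∧
      u Λ = b ∧ D Λ u Λ = b' := by
  have hre₁ : (0 : ℝ) < (1 : ℂ).re := by simp
  have hre₂ : (0 : ℝ) < (2 : ℂ).re := by simp
  have hexp (k : ℂ) : Complex.exp (k * Λ) * Complex.exp (-k * Λ) = 1 := by
    rw [← Complex.exp_add, neg_mul, add_neg_cancel, Complex.exp_zero]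
  -- Cramer's rule for the coefficients of `e^{±x}` and `e^{±2x}` at each end.
  have hf := isAC2_gluedExp hΛ hre₁ hre₁ ((2 * a - a') * Complex.exp (1 * Λ))
    ((2 * b + b') * Complex.exp (1 * Λ))
  have hg := isAC2_gluedExp hΛ hre₂ hre₂ ((a' - a) * Complex.exp (2 * Λ))
    (-(b' + b) * Complex.exp (2 * Λ))
  have hleft := hf.D_add hg (neg_mem_closedRegion Λ)
  have hright := hf.D_add hg (mem_closedRegion Λ)
  simp only [D_gluedExp hΛ _ _ _ _ (neg_mem_closedRegion Λ),
    D_gluedExp hΛ _ _ _ _ (mem_closedRegion Λ), gluedExp_neg_apply hΛ, gluedExp_of_pos hΛ]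
    at hleft hright
  refine ⟨_, hf.add hg, (memLp_gluedExp hΛ hre₁ hre₁ _ _).add (memLp_gluedExp hΛ hre₂ hre₂ _ _),
    ?_, ?_, ?_, ?_⟩
  · rw [gluedExp_neg_apply hΛ, gluedExp_neg_apply hΛ]
    linear_combination (2 * a - a') * hexp 1 + (a' - a) * hexp 2
  · rw [← hleft]
    linear_combination (2 * a - a') * hexp 1 + 2 * (a' - a) * hexp 2
  · rw [gluedExp_of_pos hΛ, gluedExp_of_pos hΛ]
    linear_combination (2 * b + b') * hexp 1 - (b' + b) * hexp 2
  · rw [← hright]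
    linear_combination -(2 * b + b') * hexp 1 + 2 * (b' + b) * hexp 2

end BoundaryValues

section CoupledConditions

variable {Λ : ℝ} {α₁ α₂ α₃ α₄ : ℂ} {u v : ℝ → ℂ}

theorem IsAC2.D_sub (hu : IsAC2 Λ u) (hv : IsAC2 Λ v) :
    EqOn (fun x => D Λ u x - D Λ v x) (D Λ (fun x => u x - v x)) (closedRegion Λ) :=
  fun x hx => (derivWithin_fun_sub (hu.diff x hx) (hv.diff x hx)).symm

theorem IsAC2.sub (hu : IsAC2 Λ u) (hv : IsAC2 Λ v) : IsAC2 Λ (fun x => u x - v x) := by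
  simpa only [neg_one_mul, ← sub_eq_add_neg] using hu.add (hv.smul (-1))

theorem BC.add (hu : IsAC2 Λ u) (hv : IsAC2 Λ v) (huBC : BC Λ α₁ α₂ α₃ α₄ u)
    (hvBC : BC Λ α₁ α₂ α₃ α₄ v) : BC Λ α₁ α₂ α₃ α₄ fun x => u x + v x := by
  rw [BC, ← hu.D_add hv (neg_mem_closedRegion Λ), ← hu.D_add hv (mem_closedRegion Λ)]
  exact ⟨by linear_combination huBC.1 + hvBC.1, by linear_combination huBC.2 + hvBC.2⟩

theorem BC.smul (c : ℂ) (hu : IsAC2 Λ u) (huBC : BC Λ α₁ α₂ α₃ α₄ u) :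
    BC Λ α₁ α₂ α₃ α₄ fun x => c * u x := by
  rw [BC, ← hu.D_smul c (neg_mem_closedRegion Λ), ← hu.D_smul c (mem_closedRegion Λ)]
  exact ⟨by linear_combination c * huBC.1, by linear_combination c * huBC.2⟩

theorem HasZeroBoundaryValues.bc (hu : HasZeroBoundaryValues Λ u) : BC Λ α₁ α₂ α₃ α₄ u := by
  simp only [BC, hu (-Λ) (by simp), hu Λ (by simp), mul_zero, add_zero, and_self]

theorem BC.hasZeroBoundaryValues_sub (hu : IsAC2 Λ u) (hv : IsAC2 Λ v)
    (huBC : BC Λ α₁ α₂ α₃ α₄ u) (hvBC : BC Λ α₁ α₂ α₃ α₄ v) (heq : u (-Λ) = v (-Λ))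
    (hDeq : D Λ u (-Λ) = D Λ v (-Λ)) : HasZeroBoundaryValues Λ fun x => u x - v x := by
  rintro x (rfl | rfl)
  · rw [← hu.D_sub hv (neg_mem_closedRegion Λ)]
    exact ⟨sub_eq_zero.2 heq, sub_eq_zero.2 hDeq⟩
  · rw [← hu.D_sub hv (mem_closedRegion x)]
    exact ⟨sub_eq_zero.2 (by rw [huBC.1, hvBC.1, heq, hDeq]),
      sub_eq_zero.2 (by rw [huBC.2, hvBC.2, heq, hDeq])⟩

/-- The boundary condition dual to `BC` under Green's formula: for every coefficient vector, the
adjoint of the restriction of `negLaplacian` by `BC` is its restriction by `AdjointBC`. -/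
def AdjointBC (Λ : ℝ) (α₁ α₂ α₃ α₄ : ℂ) (u : ℝ → ℂ) : Prop :=
  u (-Λ) = conj α₄ * u Λ - conj α₂ * D Λ u Λ ∧ D Λ u (-Λ) = conj α₁ * D Λ u Λ - conj α₃ * u Λ

theorem BC.boundaryForm_sub (hu : BC Λ α₁ α₂ α₃ α₄ u) (v : ℝ → ℂ) :
    boundaryForm Λ u v (-Λ) - boundaryForm Λ u v Λ =
      conj (u (-Λ)) * (D Λ v (-Λ) - (conj α₁ * D Λ v Λ - conj α₃ * v Λ)) -
        conj (D Λ u (-Λ)) * (v (-Λ) - (conj α₄ * v Λ - conj α₂ * D Λ v Λ)) := by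
  rw [boundaryForm, boundaryForm, hu.1, hu.2]
  simp only [map_add, map_mul]
  ring

theorem adjointBC_of_forall_boundaryForm_sub_eq_zero (hΛ : 0 < Λ)
    (hform : ∀ u, IsAC2 Λ u → MemLp u 2 (regionMeasure Λ) → BC Λ α₁ α₂ α₃ α₄ u →
      boundaryForm Λ u v (-Λ) - boundaryForm Λ u v Λ = 0) : AdjointBC Λ α₁ α₂ α₃ α₄ v := by
  have hdata (a a' : ℂ) : conj a * (D Λ v (-Λ) - (conj α₁ * D Λ v Λ - conj α₃ * v Λ)) -
      conj a' * (v (-Λ) - (conj α₄ * v Λ - conj α₂ * D Λ v Λ)) = 0 := by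
    obtain ⟨u, hu, hmem, rfl, rfl, hΛu, hΛDu⟩ := exists_isAC2_boundary_values hΛ a a'
      (α₁ * a + α₂ * a') (α₃ * a + α₄ * a')
    rw [← BC.boundaryForm_sub ⟨hΛu, hΛDu⟩]
    exact hform u hu hmem ⟨hΛu, hΛDu⟩
  have hvalue := hdata 0 1
  have hderiv := hdata 1 0
  simp only [map_zero, map_one, zero_mul, one_mul, zero_sub, sub_zero, neg_eq_zero, sub_eq_zero]
    at hvalue hderiv
  exact ⟨hvalue, hderiv⟩

theorem eq_mulVec_iff_of_mul_eq_one {n R : Type*} [Fintype n] [DecidableEq n] [CommRing R]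
    {M N : Matrix n n R} (hNM : N * M = 1) {x y : n → R} :
    x = M.mulVec y ↔ y = N.mulVec x := by
  constructor <;> rintro rfl
  · rw [Matrix.mulVec_mulVec, hNM, Matrix.one_mulVec]
  · rw [Matrix.mulVec_mulVec, mul_eq_one_comm.1 hNM, Matrix.one_mulVec]

theorem vec2_eq_mulVec_iff {R : Type*} [NonUnitalNonAssocSemiring R] {x₁ x₂ a b c d y₁ y₂ : R} :
    ![x₁, x₂] = !![a, b; c, d].mulVec ![y₁, y₂] ↔
      x₁ = a * y₁ + b * y₂ ∧ x₂ = c * y₁ + d * y₂ := by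
  simp [funext_iff, Fin.forall_fin_two, dotProduct, Fin.sum_univ_two]

theorem ClassA.conj_mul_eq_one (hA : ClassA α₁ α₂ α₃ α₄) :
    !![conj α₄, -conj α₂; -conj α₃, conj α₁] * !![α₁, α₂; α₃, α₄] = 1 := by
  obtain ⟨hdet, him₁₃, him₂₄⟩ := hA
  have hreal₁₃ := Complex.conj_eq_iff_im.2 him₁₃
  have hreal₂₄ := Complex.conj_eq_iff_im.2 him₂₄
  have hdet' := congrArg conj hdet
  simp only [map_mul, map_sub, map_one, Complex.conj_conj] at hreal₁₃ hreal₂₄ hdet'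
  rw [Matrix.mul_fin_two, Matrix.one_fin_two]
  congr! 5
  · linear_combination hdet
  · linear_combination -hreal₂₄
  · linear_combination hreal₁₃
  · linear_combination hdet'

theorem ClassA.bc_iff_adjointBC (hA : ClassA α₁ α₂ α₃ α₄) :
    BC Λ α₁ α₂ α₃ α₄ u ↔ AdjointBC Λ α₁ α₂ α₃ α₄ u := by
  rw [BC, ← vec2_eq_mulVec_iff, eq_mulVec_iff_of_mul_eq_one hA.conj_mul_eq_one, vec2_eq_mulVec_iff,
    AdjointBC]
  ring_nf

theorem mem_alphaDomain (hΛ : 0 < Λ) {ψ : L2 Λ} (hu : IsAC2 Λ u) (hψ : ψ =ᵐ[regionMeasure Λ] u)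
    (huBC : BC Λ α₁ α₂ α₃ α₄ u) : ψ ∈ alphaDomain Λ α₁ α₂ α₃ α₄ :=
  ⟨H0_adjoint_eq hΛ ▸ ⟨u, hu, hψ⟩, u, hu, hψ, huBC⟩

theorem alphaDomain_le_maxDomain : alphaDomain Λ α₁ α₂ α₃ α₄ ≤ maxDomain Λ :=
  fun _ ⟨_, u, hu, hψ, _⟩ => ⟨u, hu, hψ⟩

theorem testSpace_le_alphaDomain (hΛ : 0 < Λ) : testSpace Λ ≤ alphaDomain Λ α₁ α₂ α₃ α₄ := by
  intro φ hφ
  obtain ⟨u, hu, hφu, hzero⟩ := exists_hasZeroBoundaryValues_of_mem_testSpace hΛ.le hφ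
  exact mem_alphaDomain hΛ hu hφu hzero.bc

theorem mem_alphaDomain_iff_forall_inner (hΛ : 0 < Λ) (hA : ClassA α₁ α₂ α₃ α₄)
    (ψ : (negLaplacian Λ).domain) :
    (ψ : L2 Λ) ∈ alphaDomain Λ α₁ α₂ α₃ α₄ ↔
      ∀ φ : (negLaplacian Λ).domain, (φ : L2 Λ) ∈ alphaDomain Λ α₁ α₂ α₃ α₄ →
        inner ℂ (negLaplacian Λ φ) (ψ : L2 Λ) = inner ℂ (φ : L2 Λ) (negLaplacian Λ ψ) := by
  constructor
  · rintro ⟨-, v, hv, hψ, hvBC⟩ φ ⟨-, u, hu, hφ, huBC⟩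
    rw [hA.bc_iff_adjointBC] at hvBC
    rw [← sub_eq_zero, inner_negLaplacian_sub hΛ.le hu hv hφ hψ, huBC.boundaryForm_sub, ← hvBC.1,
      ← hvBC.2, sub_self, sub_self, mul_zero, mul_zero, sub_zero]
  · obtain ⟨v, hv, hψ⟩ := ψ.2
    refine fun hsymm => mem_alphaDomain hΛ hv hψ (hA.bc_iff_adjointBC.2 ?_)
    refine adjointBC_of_forall_boundaryForm_sub_eq_zero hΛ fun u hu hmem huBC => ?_
    have hφ := hmem.coeFn_toLp
    rw [← inner_negLaplacian_sub hΛ.le (φ := ⟨hmem.toLp u, u, hu, hφ⟩) hu hv hφ hψ, sub_eq_zero]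
    exact hsymm _ (mem_alphaDomain hΛ hu hφ huBC)

theorem isSelfAdjointExtension_Halpha (hΛ : 0 < Λ) (hA : ClassA α₁ α₂ α₃ α₄) :
    IsSelfAdjointExtension (H0 Λ) (Halpha Λ α₁ α₂ α₃ α₄) :=
  isSelfAdjointExtension_domRestrict hΛ (testSpace_le_alphaDomain hΛ)
    (mem_alphaDomain_iff_forall_inner hΛ hA)

end CoupledConditions

section Phases

theorem phase_add (s t : ℝ) : phase (s + t) = phase s * phase t := by
  rw [phase, phase, phase, ← Complex.exp_add, ← add_mul, Complex.ofReal_add]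

theorem norm_phase (t : ℝ) : ‖phase t‖ = 1 := Complex.norm_exp_ofReal_mul_I t

theorem phase_re (t : ℝ) : (phase t).re = Real.cos t := Complex.exp_ofReal_mul_I_re t

theorem phase_eq (t : ℝ) : phase t = Real.cos t + Real.sin t * Complex.I := by
  rw [phase, Complex.exp_mul_I, Complex.ofReal_cos, Complex.ofReal_sin]

theorem phase_neg (t : ℝ) : phase (-t) = (phase t)⁻¹ := by
  rw [phase, phase, ← Complex.exp_neg, Complex.ofReal_neg, neg_mul]

theorem phase_add_pi (t : ℝ) : phase (t + Real.pi) = -phase t := by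
  rw [phase_add, phase, phase, Complex.exp_pi_mul_I, mul_neg_one]

theorem conj_phase (t : ℝ) : conj (phase t) = phase (-t) := by
  rw [phase, phase, ← Complex.exp_conj, map_mul, Complex.conj_ofReal, Complex.conj_I,
    Complex.ofReal_neg, neg_mul_comm]

theorem phase_three_pi_div_four : phase (3 * Real.pi / 4) = -phase (-(Real.pi / 4)) := by
  rw [← phase_add_pi]
  ring_nf

theorem phase_neg_three_pi_div_four : phase (-(3 * Real.pi / 4)) = -phase (Real.pi / 4) := by
  rw [phase_neg, phase_three_pi_div_four, phase_neg, inv_neg, inv_inv]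

theorem ofReal_sqrt_two_sq : ((√2 : ℝ) : ℂ) ^ 2 = 2 := by
  rw [← Complex.ofReal_pow, Real.sq_sqrt zero_le_two, Complex.ofReal_ofNat]

theorem ofReal_sqrt_two_ne_zero : ((√2 : ℝ) : ℂ) ≠ 0 :=
  pow_ne_zero_iff two_ne_zero |>.1 (ofReal_sqrt_two_sq ▸ two_ne_zero)

theorem phase_pi_div_four : phase (Real.pi / 4) = (1 + Complex.I) / (√2 : ℝ) := by
  rw [phase_eq, Real.cos_pi_div_four, Real.sin_pi_div_four, eq_div_iff ofReal_sqrt_two_ne_zero,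
    Complex.ofReal_div, Complex.ofReal_ofNat]
  linear_combination (1 + Complex.I) / 2 * ofReal_sqrt_two_sq

theorem phase_neg_pi_div_four : phase (-(Real.pi / 4)) = (1 - Complex.I) / (√2 : ℝ) := by
  rw [← conj_phase, phase_pi_div_four, map_div₀, map_add, map_one, Complex.conj_I,
    Complex.conj_ofReal, sub_eq_add_neg]

theorem phase_pi_div_four_sub :
    phase (Real.pi / 4) - phase (-(Real.pi / 4)) = (√2 : ℝ) * Complex.I := by
  rw [phase_pi_div_four, phase_neg_pi_div_four, ← sub_div, div_eq_iff ofReal_sqrt_two_ne_zero]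
  linear_combination -Complex.I * ofReal_sqrt_two_sq

theorem phase_pi_div_four_ne : phase (Real.pi / 4) ≠ phase (-(Real.pi / 4)) := by
  rw [← sub_ne_zero, phase_pi_div_four_sub]
  exact mul_ne_zero ofReal_sqrt_two_ne_zero Complex.I_ne_zero

theorem phase_mul_phase_neg (t : ℝ) : phase t * phase (-t) = 1 := by
  rw [phase_neg]
  exact mul_inv_cancel₀ (Complex.exp_ne_zero _)

end Phases

section System

variable {α₁ α₂ α₃ α₄ : ℂ}

theorem ClassA.conj_mul_sub_conj_mul (hA : ClassA α₁ α₂ α₃ α₄) (a b : ℂ) :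
    conj (α₁ * a + α₂ * b) * (α₃ * a + α₄ * b) - conj (α₃ * a + α₄ * b) * (α₁ * a + α₂ * b) =
      conj a * b - conj b * a := by
  have hdet := hA.1
  have hdet_conj := congrArg conj hA.1
  have hreal₁₃ := Complex.conj_eq_iff_im.2 hA.2.1
  have hreal₂₄ := Complex.conj_eq_iff_im.2 hA.2.2
  simp only [map_mul, map_sub, map_one, Complex.conj_conj] at hdet_conj hreal₁₃ hreal₂₄ ⊢
  simp only [map_add, map_mul]
  linear_combination conj a * b * hdet_conj - a * conj b * hdet + a * conj a * hreal₁₃ +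
    b * conj b * hreal₂₄

-- With `w = α₁ + α₂ z` the hypothesis reads `α₃ + α₄ z = -conj z * w`, so the data `(1, z)` and
-- their image `(w, -conj z * w)` have the boundary forms `z - conj z` and `(z - conj z) ‖w‖ ^ 2`.
theorem ClassA.norm_add_mul_eq_one {z : ℂ} (hA : ClassA α₁ α₂ α₃ α₄) (hz : ‖z‖ = 1)
    (hne : z ≠ conj z) (hzα : α₁ + α₂ * z = (α₃ + α₄ * z) * -z) : ‖α₁ + α₂ * z‖ = 1 := by
  have hzz : z * conj z = 1 := by rw [Complex.mul_conj', hz, Complex.ofReal_one, one_pow]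
  have himage : α₃ + α₄ * z = -conj z * (α₁ + α₂ * z) := by
    linear_combination conj z * hzα - (α₃ + α₄ * z) * hzz
  have hform := hA.conj_mul_sub_conj_mul 1 z
  simp only [mul_one, himage, map_mul, map_neg, Complex.conj_conj, map_one, one_mul] at hform
  suffices (‖α₁ + α₂ * z‖ : ℂ) ^ 2 = 1 from
    (pow_eq_one_iff_of_nonneg (norm_nonneg _) two_ne_zero).1 (by exact_mod_cast this)
  rw [← Complex.mul_conj']
  exact mul_left_cancel₀ (sub_ne_zero.2 hne) (by linear_combination hform)

theorem SystemS.norm_eq_one {G : ℂ → ℂ → ℂ} (hS : SystemS G α₁ α₂ α₃ α₄)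
    (hA : ClassA α₁ α₂ α₃ α₄) :
    ‖α₁ + α₂ * phase (-(Real.pi / 4))‖ = 1 ∧ ‖α₁ + α₂ * phase (Real.pi / 4)‖ = 1 := by
  obtain ⟨-, hneg, hpos⟩ := hS
  rw [phase_three_pi_div_four] at hneg
  rw [phase_neg_three_pi_div_four] at hpos
  constructor
  · refine hA.norm_add_mul_eq_one (norm_phase _) ?_ hneg
    rw [conj_phase, neg_neg]
    exact phase_pi_div_four_ne.symm
  · refine hA.norm_add_mul_eq_one (norm_phase _) ?_ hpos
    rw [conj_phase]
    exact phase_pi_div_four_ne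

theorem SystemS.mul_phase_eq {G : ℂ → ℂ → ℂ} (hS : SystemS G α₁ α₂ α₃ α₄) (t : ℝ) :
    (α₁ + α₂ * phase (-(Real.pi / 4))) * phase t =
      (α₃ + α₄ * phase (-(Real.pi / 4))) * phase (t + 3 * Real.pi / 4) := by
  rw [hS.2.1, phase_add, mul_assoc, mul_comm (phase t)]

theorem SystemS.inv_mul_phase_eq {G : ℂ → ℂ → ℂ} (hS : SystemS G α₁ α₂ α₃ α₄) (t : ℝ) :
    (α₁ + α₂ * phase (Real.pi / 4))⁻¹ * phase t =
      (α₃ + α₄ * phase (Real.pi / 4))⁻¹ * phase (t + 3 * Real.pi / 4) := by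
  rw [hS.2.2, phase_add, mul_inv, phase_neg, inv_inv, mul_assoc, mul_comm (phase t)]

end System

section DeficiencyWaves

variable {Λ : ℝ} {α₁ α₂ α₃ α₄ : ℂ} {G : ℂ → ℂ → ℂ}

/-- The function `L₊ + γ_→ R₋` on `Ω_Λ`, extended through the junction. -/
noncomputable def leftWave (Λ : ℝ) (γr : ℂ) : ℝ → ℂ :=
  gluedExp (normFactor Λ) (phase (-(Real.pi / 4))) (normFactor Λ * γr) (phase (Real.pi / 4))

/-- The function `R₊ + γ_← L₋` on `Ω_Λ`, extended through the junction. -/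
noncomputable def rightWave (Λ : ℝ) (γl : ℂ) : ℝ → ℂ :=
  gluedExp (normFactor Λ * γl) (phase (Real.pi / 4)) (normFactor Λ) (phase (-(Real.pi / 4)))

/-- The element `c_L (L₊ + γ_→ R₋) + c_R (R₊ + γ_← L₋)` of the complement of `D(H₀)` in
`gammaDomain`. -/
noncomputable def deficiencyWave (Λ : ℝ) (γr γl cL cR : ℂ) (x : ℝ) : ℂ :=
  cL * leftWave Λ γr x + cR * rightWave Λ γl x

theorem phase_pi_div_four_re_pos : 0 < (phase (Real.pi / 4)).re := by
  rw [phase_re, Real.cos_pi_div_four]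
  positivity

theorem phase_neg_pi_div_four_re_pos : 0 < (phase (-(Real.pi / 4))).re := by
  rw [phase_re, Real.cos_neg, Real.cos_pi_div_four]
  positivity

theorem normFactor_ne_zero (Λ : ℝ) : (normFactor Λ : ℂ) ≠ 0 := by
  rw [Complex.ofReal_ne_zero, normFactor]
  positivity

theorem eqOn_leftWave (hΛ : 0 < Λ) (γr : ℂ) :
    EqOn (leftWave Λ γr) (fun x => Lplus Λ x + γr * Rminus Λ x) (region Λ) := by
  rintro x ((hx : x < -Λ) | (hx : Λ < x)) <;> simp only [leftWave, Lplus, Rminus]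
  · rw [gluedExp_of_neg (by linarith), phase_neg_pi_div_four, if_pos hx, if_neg (by linarith)]
    ring_nf
  · rw [gluedExp_of_pos (by linarith), phase_pi_div_four, if_neg (by linarith), if_pos hx]
    ring_nf

theorem eqOn_rightWave (hΛ : 0 < Λ) (γl : ℂ) :
    EqOn (rightWave Λ γl) (fun x => Rplus Λ x + γl * Lminus Λ x) (region Λ) := by
  rintro x ((hx : x < -Λ) | (hx : Λ < x)) <;> simp only [rightWave, Rplus, Lminus]
  · rw [gluedExp_of_neg (by linarith), phase_pi_div_four, if_neg (by linarith), if_pos hx]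
    ring_nf
  · rw [gluedExp_of_pos (by linarith), phase_neg_pi_div_four, if_pos hx, if_neg (by linarith)]
    ring_nf

theorem isAC2_leftWave (hΛ : 0 < Λ) (γr : ℂ) : IsAC2 Λ (leftWave Λ γr) :=
  isAC2_gluedExp hΛ phase_neg_pi_div_four_re_pos phase_pi_div_four_re_pos _ _

theorem isAC2_rightWave (hΛ : 0 < Λ) (γl : ℂ) : IsAC2 Λ (rightWave Λ γl) :=
  isAC2_gluedExp hΛ phase_pi_div_four_re_pos phase_neg_pi_div_four_re_pos _ _

theorem isAC2_deficiencyWave (hΛ : 0 < Λ) (γr γl cL cR : ℂ) :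
    IsAC2 Λ (deficiencyWave Λ γr γl cL cR) :=
  ((isAC2_leftWave hΛ γr).smul cL).add ((isAC2_rightWave hΛ γl).smul cR)

theorem memLp_deficiencyWave (hΛ : 0 < Λ) (γr γl cL cR : ℂ) :
    MemLp (deficiencyWave Λ γr γl cL cR) 2 (regionMeasure Λ) :=
  ((memLp_gluedExp hΛ phase_neg_pi_div_four_re_pos phase_pi_div_four_re_pos _ _).const_mul cL).add
    ((memLp_gluedExp hΛ phase_pi_div_four_re_pos phase_neg_pi_div_four_re_pos _ _).const_mul cR)

theorem bc_gluedExp (hΛ : 0 < Λ) {A k B m : ℂ} (hkm : k * m = 1)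
    (hk : α₁ + α₂ * k = (α₃ + α₄ * k) * -k)
    (hAB : B * Complex.exp (-m * Λ) = (α₁ + α₂ * k) * (A * Complex.exp (-k * Λ))) :
    BC Λ α₁ α₂ α₃ α₄ (gluedExp A k B m) := by
  rw [BC, D_gluedExp hΛ _ _ _ _ (neg_mem_closedRegion Λ),
    D_gluedExp hΛ _ _ _ _ (mem_closedRegion Λ)]
  simp only [gluedExp_neg_apply hΛ, gluedExp_of_pos hΛ]
  constructor
  · linear_combination hAB
  · linear_combination -m * hAB - m * A * Complex.exp (-k * Λ) * hk +
      (α₃ + α₄ * k) * A * Complex.exp (-k * Λ) * hkm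

theorem phase_sqrt_two_mul_exp (Λ : ℝ) :
    phase (√2 * Λ) * Complex.exp (-phase (Real.pi / 4) * Λ) =
      Complex.exp (-phase (-(Real.pi / 4)) * Λ) := by
  rw [phase, ← Complex.exp_add, Complex.ofReal_mul]
  congr 1
  linear_combination -Λ * phase_pi_div_four_sub

theorem SystemS.bc_leftWave (hΛ : 0 < Λ) (hS : SystemS G α₁ α₂ α₃ α₄) :
    BC Λ α₁ α₂ α₃ α₄
      (leftWave Λ ((α₁ + α₂ * phase (-(Real.pi / 4))) * phase (√2 * Λ))) := by
  refine bc_gluedExp hΛ ?_ ?_ ?_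
  · rw [mul_comm, phase_mul_phase_neg]
  · rw [hS.2.1, phase_three_pi_div_four]
  · rw [← phase_sqrt_two_mul_exp]
    ring

theorem SystemS.bc_rightWave (hΛ : 0 < Λ) (hS : SystemS G α₁ α₂ α₃ α₄)
    (hne : α₁ + α₂ * phase (Real.pi / 4) ≠ 0) :
    BC Λ α₁ α₂ α₃ α₄ (rightWave Λ ((α₁ + α₂ * phase (Real.pi / 4))⁻¹ * phase (√2 * Λ))) := by
  refine bc_gluedExp hΛ (phase_mul_phase_neg _) ?_ ?_
  · rw [hS.2.2, phase_neg_three_pi_div_four]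
  · rw [← phase_sqrt_two_mul_exp]
    linear_combination -normFactor Λ * phase (√2 * Λ) *
      Complex.exp (-phase (Real.pi / 4) * Λ) * mul_inv_cancel₀ hne

theorem bc_deficiencyWave (hΛ : 0 < Λ) {γr γl : ℂ} (hleft : BC Λ α₁ α₂ α₃ α₄ (leftWave Λ γr))
    (hright : BC Λ α₁ α₂ α₃ α₄ (rightWave Λ γl)) (cL cR : ℂ) :
    BC Λ α₁ α₂ α₃ α₄ (deficiencyWave Λ γr γl cL cR) :=
  BC.add ((isAC2_leftWave hΛ γr).smul cL) ((isAC2_rightWave hΛ γl).smul cR)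
    (hleft.smul cL (isAC2_leftWave hΛ γr)) (hright.smul cR (isAC2_rightWave hΛ γl))

theorem D_deficiencyWave_neg_apply (hΛ : 0 < Λ) (γr γl cL cR : ℂ) :
    D Λ (deficiencyWave Λ γr γl cL cR) (-Λ) =
      phase (-(Real.pi / 4)) * (cL * leftWave Λ γr (-Λ)) +
        phase (Real.pi / 4) * (cR * rightWave Λ γl (-Λ)) := by
  have hleft := (isAC2_leftWave hΛ γr).D_smul cL (neg_mem_closedRegion Λ)
  have hright := (isAC2_rightWave hΛ γl).D_smul cR (neg_mem_closedRegion Λ)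
  have hadd := ((isAC2_leftWave hΛ γr).smul cL).D_add ((isAC2_rightWave hΛ γl).smul cR)
    (neg_mem_closedRegion Λ)
  simp only [← hleft, ← hright] at hadd
  unfold deficiencyWave
  rw [← hadd, leftWave, rightWave, D_gluedExp hΛ _ _ _ _ (neg_mem_closedRegion Λ),
    D_gluedExp hΛ _ _ _ _ (neg_mem_closedRegion Λ)]
  simp only [gluedExp_neg_apply hΛ]
  ring

theorem exists_add_eq_and_mul_add_mul_eq {K : Type*} [Field K] {z w : K} (hne : z ≠ w)
    (a b : K) : ∃ x y, x + y = a ∧ z * x + w * y = b := by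
  have hsub := sub_ne_zero.2 hne
  exact ⟨(b - w * a) / (z - w), (z * a - b) / (z - w), by field_simp; ring, by field_simp; ring⟩

theorem exists_deficiencyWave_boundary_values (hΛ : 0 < Λ) (γr : ℂ) {γl : ℂ} (hγl : γl ≠ 0)
    (a a' : ℂ) :
    ∃ cL cR, deficiencyWave Λ γr γl cL cR (-Λ) = a ∧
      D Λ (deficiencyWave Λ γr γl cL cR) (-Λ) = a' := by
  have hleft : leftWave Λ γr (-Λ) ≠ 0 := by
    rw [leftWave, gluedExp_neg_apply hΛ]
    exact mul_ne_zero (normFactor_ne_zero Λ) (Complex.exp_ne_zero _)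
  have hright : rightWave Λ γl (-Λ) ≠ 0 := by
    rw [rightWave, gluedExp_neg_apply hΛ]
    exact mul_ne_zero (mul_ne_zero (normFactor_ne_zero Λ) hγl) (Complex.exp_ne_zero _)
  obtain ⟨x, y, hvalue, hderiv⟩ := exists_add_eq_and_mul_add_mul_eq phase_pi_div_four_ne.symm a a'
  refine ⟨x / leftWave Λ γr (-Λ), y / rightWave Λ γl (-Λ), ?_, ?_⟩
  · rw [deficiencyWave, div_mul_cancel₀ _ hleft, div_mul_cancel₀ _ hright, hvalue]
  · rw [D_deficiencyWave_neg_apply hΛ, div_mul_cancel₀ _ hleft, div_mul_cancel₀ _ hright, hderiv]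

theorem mem_gammaDomain_iff (hΛ : 0 < Λ) {γr γl : ℂ} {ψ : L2 Λ} :
    ψ ∈ gammaDomain Λ γr γl ↔
      ∃ cL cR, ψ - (memLp_deficiencyWave hΛ γr γl cL cR).toLp ∈ (H0 Λ).domain := by
  have hwave (cL cR : ℂ) : (memLp_deficiencyWave hΛ γr γl cL cR).toLp =ᵐ[regionMeasure Λ]
      fun x => cL * (Lplus Λ x + γr * Rminus Λ x) + cR * (Rplus Λ x + γl * Lminus Λ x) := by
    filter_upwards [MemLp.coeFn_toLp (memLp_deficiencyWave hΛ γr γl cL cR), ae_mem_region Λ]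
      with x hx hxΛ
    rw [hx, deficiencyWave, eqOn_leftWave hΛ γr hxΛ, eqOn_rightWave hΛ γl hxΛ]
  constructor
  · rintro ⟨ψ₀, hψ₀, cL, cR, hψ⟩
    suffices ψ - (memLp_deficiencyWave hΛ γr γl cL cR).toLp = ψ₀ from ⟨cL, cR, this ▸ hψ₀⟩
    apply Lp.ext
    filter_upwards [hψ, hwave cL cR, Lp.coeFn_sub ψ (memLp_deficiencyWave hΛ γr γl cL cR).toLp]
      with x hx hwx hsub
    rw [hsub, Pi.sub_apply, hx, hwx]
    ring
  · rintro ⟨cL, cR, hψ₀⟩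
    refine ⟨_, hψ₀, cL, cR, ?_⟩
    filter_upwards [hwave cL cR, Lp.coeFn_sub ψ (memLp_deficiencyWave hΛ γr γl cL cR).toLp]
      with x hwx hsub
    rw [hsub, Pi.sub_apply, hwx]
    ring

theorem gammaDomain_le_alphaDomain (hΛ : 0 < Λ) {γr γl : ℂ}
    (hleft : BC Λ α₁ α₂ α₃ α₄ (leftWave Λ γr)) (hright : BC Λ α₁ α₂ α₃ α₄ (rightWave Λ γl))
    (hH0 : (H0 Λ).domain ≤ alphaDomain Λ α₁ α₂ α₃ α₄) :
    gammaDomain Λ γr γl ≤ alphaDomain Λ α₁ α₂ α₃ α₄ := by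
  intro ψ hψ
  obtain ⟨cL, cR, hψ₀⟩ := (mem_gammaDomain_iff hΛ).1 hψ
  have hwave : (memLp_deficiencyWave hΛ γr γl cL cR).toLp ∈ alphaDomain Λ α₁ α₂ α₃ α₄ :=
    mem_alphaDomain hΛ (isAC2_deficiencyWave hΛ γr γl cL cR) (MemLp.coeFn_toLp _)
      (bc_deficiencyWave hΛ hleft hright cL cR)
  simpa only [sub_add_cancel] using add_mem (hH0 hψ₀) hwave

theorem alphaDomain_le_gammaDomain (hΛ : 0 < Λ) {γr γl : ℂ} (hγl : γl ≠ 0)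
    (hleft : BC Λ α₁ α₂ α₃ α₄ (leftWave Λ γr)) (hright : BC Λ α₁ α₂ α₃ α₄ (rightWave Λ γl)) :
    alphaDomain Λ α₁ α₂ α₃ α₄ ≤ gammaDomain Λ γr γl := by
  rintro ψ ⟨-, u, hu, hψ, huBC⟩
  obtain ⟨cL, cR, hvalue, hderiv⟩ :=
    exists_deficiencyWave_boundary_values hΛ γr hγl (u (-Λ)) (D Λ u (-Λ))
  have hv := isAC2_deficiencyWave hΛ γr γl cL cR
  refine (mem_gammaDomain_iff hΛ).2 ⟨cL, cR, ?_⟩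
  refine mem_H0_domain_of_hasZeroBoundaryValues hΛ (hu.sub hv) ?_ (huBC.hasZeroBoundaryValues_sub
    hu hv (bc_deficiencyWave hΛ hleft hright cL cR) hvalue.symm hderiv.symm)
  exact (Lp.coeFn_sub _ _).trans (hψ.sub (MemLp.coeFn_toLp _))

theorem SystemS.alphaDomain_eq_gammaDomain (hΛ : 0 < Λ) (hA : ClassA α₁ α₂ α₃ α₄)
    (hS : SystemS G α₁ α₂ α₃ α₄) :
    alphaDomain Λ α₁ α₂ α₃ α₄ =
      gammaDomain Λ ((α₁ + α₂ * phase (-(Real.pi / 4))) * phase (√2 * Λ))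
        ((α₁ + α₂ * phase (Real.pi / 4))⁻¹ * phase (√2 * Λ)) := by
  have hne : α₁ + α₂ * phase (Real.pi / 4) ≠ 0 :=
    norm_ne_zero_iff.1 ((hS.norm_eq_one hA).2 ▸ one_ne_zero)
  have hright := hS.bc_rightWave hΛ hne
  have hH0 : (H0 Λ).domain ≤ alphaDomain Λ α₁ α₂ α₃ α₄ := by
    rw [← domain_domRestrict_negLaplacian alphaDomain_le_maxDomain]
    exact (isSelfAdjointExtension_Halpha hΛ hA).1.1
  exact le_antisymm
    (alphaDomain_le_gammaDomain hΛ (mul_ne_zero (inv_ne_zero hne) (Complex.exp_ne_zero _))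
      (hS.bc_leftWave hΛ) hright)
    (gammaDomain_le_alphaDomain hΛ (hS.bc_leftWave hΛ) hright hH0)

theorem SystemS.Halpha_eq_Hgamma (hΛ : 0 < Λ) (hA : ClassA α₁ α₂ α₃ α₄)
    (hS : SystemS G α₁ α₂ α₃ α₄) :
    Halpha Λ α₁ α₂ α₃ α₄ =
      Hgamma Λ ((α₁ + α₂ * phase (-(Real.pi / 4))) * phase (√2 * Λ))
        ((α₁ + α₂ * phase (Real.pi / 4))⁻¹ * phase (√2 * Λ)) := by
  rw [Halpha, Hgamma, hS.alphaDomain_eq_gammaDomain hΛ hA]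

end DeficiencyWaves

end Junction

theorem mainTheorem3 (Λ : ℝ) (hΛ : 0 < Λ) (α₁ α₂ α₃ α₄ : ℂ)
    (hA : Junction.ClassA α₁ α₂ α₃ α₄) :
    Junction.IsSelfAdjointExtension (Junction.H0 Λ) (Junction.Halpha Λ α₁ α₂ α₃ α₄) ∧
    ((Junction.SystemS Junction.F α₁ α₂ α₃ α₄ ∨
        Junction.SystemS Junction.Fconj α₁ α₂ α₃ α₄) →
      ∀ γr γl : ℂ,
        γr = (α₁ + α₂ * Junction.phase (-(Real.pi / 4))) * Junction.phase (√2 * Λ) →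
        γl = (α₁ + α₂ * Junction.phase (Real.pi / 4))⁻¹ * Junction.phase (√2 * Λ) →
        γr = (α₃ + α₄ * Junction.phase (-(Real.pi / 4))) *
            Junction.phase (√2 * Λ + 3 * Real.pi / 4) ∧
        γl = (α₃ + α₄ * Junction.phase (Real.pi / 4))⁻¹ *
            Junction.phase (√2 * Λ + 3 * Real.pi / 4) ∧
        ‖γr‖ = 1 ∧ ‖γl‖ = 1 ∧
        (Junction.Hgamma Λ γr γl).domain = Junction.gammaDomain Λ γr γl ∧
        Junction.IsSelfAdjointExtension (Junction.H0 Λ) (Junction.Hgamma Λ γr γl) ∧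
        Junction.Halpha Λ α₁ α₂ α₃ α₄ = Junction.Hgamma Λ γr γl) := by
  refine ⟨Junction.isSelfAdjointExtension_Halpha hΛ hA, ?_⟩
  rintro hF γr γl rfl rfl
  obtain ⟨G, hS⟩ : ∃ G, Junction.SystemS G α₁ α₂ α₃ α₄ := hF.elim (⟨_, ·⟩) (⟨_, ·⟩)
  obtain ⟨hleft, hright⟩ := hS.norm_eq_one hA
  have hdom := hS.alphaDomain_eq_gammaDomain hΛ hA
  have hH := hS.Halpha_eq_Hgamma hΛ hA
  refine ⟨hS.mul_phase_eq _, hS.inv_mul_phase_eq _, ?_, ?_,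
    Junction.domain_domRestrict_negLaplacian (hdom ▸ Junction.alphaDomain_le_maxDomain),
    hH ▸ Junction.isSelfAdjointExtension_Halpha hΛ hA, hH⟩
  · rw [norm_mul, Junction.norm_phase, hleft, mul_one]
  · rw [norm_mul, norm_inv, Junction.norm_phase, hright, inv_one, mul_one]
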